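/- Call a polynomial $f\in\mathbb R_{\ge 0}[x_1,\dots,x_n]$ (real, with nonnegative coefficients) \emph{log concave} if $\log f$ is a concave function on $\mathbb R^n_{>0}$ (equivalently, $\log f$ is concave on $\{x\in\mathbb R^n_{\ge 0} : f(x)>0\}$); the zero polynomial counts as log concave. Consider random access machines with exact arithmetic. Such a machine has index registers holding natural numbers (which can be set to zero, incremented, copied and compared) and arrays of cells holding elements of an ordered field, addressed by index registers; cells can be set to an integer constant, copied, combined by $+,-,\times,\div$ (division by $0$ returning $0$), and compared by $\le$. Programs are finite, built from these instructions by sequencing, branching and while loops, and every instruction or test counts as one step. A homogeneous cubic $f$ in $n$ variables is given to the machine by the number $n$ and the array of the coefficients in $f$ of the monomials $x_ix_jx_k$, $1\le i,j,k\le n$. \textbf{Corollary.} There is a polynomial-time algorithm that decides whether a homogeneous cubic polynomial with nonnegative coefficients is log concave on the nonnegative orthant. Precisely, there are a single program $P$, a constant $C$ and a polynomial $p$ such that: (1) for every $n\ge 0$ and every homogeneous polynomial $f\in\mathbb R_{\ge 0}[x_1,\dots,x_n]$ of degree three (or zero), the program $P$, run over $\mathbb R$ on the input $f$, halts after at most $C(n+1)^4$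 steps and correctly answers whether $f$ is log concave; (2) for every $n\ge 0$ and every such $f$ with rational coefficients, the program $P$, run over $\mathbb Q$ on the input $f$, halts after at most $C(n+1)^4$ steps and correctly answers whether $f$ is log concave, and at every time every rational number stored in a cell has bit length (numerator plus denominator, in lowest terms) at most $p(L)$, where $L$ is $n$ plus the sum of the bit lengths of the nonzero coefficients of $f$. In particular, the running time is polynomial in the bit model as well. -/

import Mathlib

/-! ## Log concavity -/

/-- A polynomial `f` (with nonnegative coefficients) is log concave if `log f` is a concave function
on the open positive orthant. (A nonzero `f` with nonnegative coefficients is positive there; the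
zero polynomial counts as log concave.) By `isLogConcave_iff_nonneg_orthant` below, this is the same
as concavity of `log f` on the part of the closed nonnegative orthant where `log f` is defined. -/
def IsLogConcave {n : ℕ} (f : MvPolynomial (Fin n) ℝ) : Prop :=
  ConcaveOn ℝ {x : Fin n → ℝ | ∀ i, 0 < x i} (fun x => Real.log (MvPolynomial.eval x f))

theorem eval_pos_of_coeff_nonneg {n : ℕ} {f : MvPolynomial (Fin n) ℝ} (hf : ∀ m, 0 ≤ f.coeff m)
    (h0 : f ≠ 0) {x : Fin n → ℝ} (hx : ∀ i, 0 < x i) : 0 < MvPolynomial.eval x f := by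
  rw [MvPolynomial.eval_eq]
  refine Finset.sum_pos (fun m hm => ?_) (MvPolynomial.support_nonempty.2 h0)
  refine mul_pos (lt_of_le_of_ne (hf m) (Ne.symm (MvPolynomial.mem_support_iff.1 hm))) ?_
  exact Finset.prod_pos fun i _ => pow_pos (hx i) _

theorem isLogConcave_iff_nonneg_orthant {n : ℕ} {f : MvPolynomial (Fin n) ℝ}
    (hf : ∀ m, 0 ≤ f.coeff m) :
    IsLogConcave f ↔
      ConcaveOn ℝ {x : Fin n → ℝ | (∀ i, 0 ≤ x i) ∧ 0 < MvPolynomial.eval x f}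
        (fun x => Real.log (MvPolynomial.eval x f)) := by
  have hconv : Convex ℝ {x : Fin n → ℝ | ∀ i, 0 < x i} := by
    intro x hx y hy a b ha hb hab i
    simp only [Pi.add_apply, Pi.smul_apply, smul_eq_mul]
    rcases ha.eq_or_lt with rfl | ha'
    · have : b = 1 := by linarith
      subst this
      simpa using hy i
    · have h1 := mul_pos ha' (hx i)
      have h2 := mul_nonneg hb (hy i).le
      linarith
  by_cases h0 : f = 0
  · subst h0
    simp only [IsLogConcave, map_zero, lt_irrefl, and_false, Set.ofPred_false, Real.log_zero]
    exact iff_of_true (concaveOn_const 0 hconv) ⟨convex_empty, by simp⟩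
  constructor
  · intro h
    have key : ∀ x ∈ {x : Fin n → ℝ | (∀ i, 0 ≤ x i) ∧ 0 < MvPolynomial.eval x f},
        ∀ y ∈ {x : Fin n → ℝ | (∀ i, 0 ≤ x i) ∧ 0 < MvPolynomial.eval x f},
        ∀ a b : ℝ, 0 ≤ a → 0 ≤ b → a + b = 1 →
          Real.exp (a * Real.log (MvPolynomial.eval x f) + b * Real.log (MvPolynomial.eval y f))
            ≤ MvPolynomial.eval (a • x + b • y) f := by
      rintro x ⟨hx, hfx⟩ y ⟨hy, hfy⟩ a b ha hb hab
      have hc : ∀ z : Fin n → ℝ, Filter.Tendsto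
          (fun e : ℝ => MvPolynomial.eval (z + e • (1 : Fin n → ℝ)) f)
          (nhdsWithin 0 (Set.Ioi 0)) (nhds (MvPolynomial.eval z f)) := by
        intro z
        have hcont : Continuous (fun e : ℝ => MvPolynomial.eval (z + e • (1 : Fin n → ℝ)) f) :=
          (MvPolynomial.continuous_eval f).comp (by fun_prop)
        have := (hcont.tendsto 0).mono_left (nhdsWithin_le_nhds (s := Set.Ioi 0))
        simpa using this
      refine le_of_tendsto_of_tendsto (Filter.Tendsto.rexp
        ((((hc x).log hfx.ne').const_mul a).add (((hc y).log hfy.ne').const_mul b)))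
        (hc (a • x + b • y)) ?_
      filter_upwards [self_mem_nhdsWithin] with e he
      have he' : 0 < e := he
      have hx' : ∀ i, 0 < (x + e • (1 : Fin n → ℝ)) i := fun i => by
        have := hx i
        simp only [Pi.add_apply, Pi.smul_apply, Pi.one_apply, smul_eq_mul]
        linarith
      have hy' : ∀ i, 0 < (y + e • (1 : Fin n → ℝ)) i := fun i => by
        have := hy i
        simp only [Pi.add_apply, Pi.smul_apply, Pi.one_apply, smul_eq_mul]
        linarith
      have hxy : a • (x + e • (1 : Fin n → ℝ)) + b • (y + e • (1 : Fin n → ℝ))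
          = a • x + b • y + e • (1 : Fin n → ℝ) := by
        have hb' : b = 1 - a := by linarith
        subst hb'
        module
      have h1 := h.2 hx' hy' ha hb hab
      have hp := eval_pos_of_coeff_nonneg hf h0 (hconv hx' hy' ha hb hab)
      simp only [hxy, smul_eq_mul] at h1 hp
      exact (Real.le_log_iff_exp_le hp).1 h1
    refine ⟨?_, ?_⟩
    · intro x hx y hy a b ha hb hab
      refine ⟨fun i => ?_, lt_of_lt_of_le (Real.exp_pos _) (key x hx y hy a b ha hb hab)⟩
      simp only [Pi.add_apply, Pi.smul_apply, smul_eq_mul]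
      exact add_nonneg (mul_nonneg ha (hx.1 i)) (mul_nonneg hb (hy.1 i))
    · intro x hx y hy a b ha hb hab
      have h1 := key x hx y hy a b ha hb hab
      exact (Real.le_log_iff_exp_le (lt_of_lt_of_le (Real.exp_pos _) h1)).2 h1
  · intro h
    exact h.subset (fun x hx => ⟨fun i => (hx i).le, eval_pos_of_coeff_nonneg hf h0 hx⟩) hconv

/-! ## A random access machine with exact arithmetic

A program is a finite piece of syntax that does not mention the field. The machine has

* index registers `0, 1, 2, …`, each holding a natural number, which can only be set to zero,
  incremented, copied and compared, so that their contents stay bounded by the input dimension plus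
  the number of steps made;
* number cells, organised in arrays `0, 1, 2, …`, each with three indices. A cell is addressed by the
  name of its array and by three index registers. Cells hold elements of an ordered field, and can
  be set to an integer constant, copied, combined by `+, -, *, /`, and compared by `≤`.

Every instruction and every test is one step. -/

namespace ArithRAM

/-- The reference `⟨a, i, j, k⟩` to the cell of array `a` at the position given by the current
contents of the index registers `i`, `j`, `k`. -/
structure Cell where
  arr : ℕ
  i : ℕ
  j : ℕ
  k : ℕ

/-- The arithmetic operations of the machine. -/
inductive Op where
  | add
  | sub
  | mul
  | div

/-- The tests of the machine. -/
inductive Test where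
  /-- the content of index register `r` is less than that of index register `s` -/
  | idxLt (r s : ℕ)
  /-- the number in cell `a` is at most the number in cell `b` -/
  | numLe (a b : Cell)

/-- The programs of the machine. -/
inductive Program where
  | skip
  /-- `r := 0` -/
  | idxZero (r : ℕ)
  /-- `r := r + 1` -/
  | idxSucc (r : ℕ)
  /-- `r := s` -/
  | idxCopy (r s : ℕ)
  /-- `c := z` -/
  | const (c : Cell) (z : ℤ)
  /-- `c := a` -/
  | copy (c a : Cell)
  /-- `c := a o b` -/
  | arith (o : Op) (c a b : Cell)
  | seq (P Q : Program)
  | ite (b : Test) (P Q : Program)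
  | while (b : Test) (P : Program)

/-- The memory of the machine over `K`. -/
structure Memory (K : Type) where
  idx : ℕ → ℕ
  num : ℕ → ℕ → ℕ → ℕ → K

/-- The number in a cell. -/
def Memory.read {K : Type} (s : Memory K) (c : Cell) : K :=
  s.num c.arr (s.idx c.i) (s.idx c.j) (s.idx c.k)

/-- Overwrite the number in a cell. -/
def Memory.write {K : Type} (s : Memory K) (c : Cell) (x : K) : Memory K where
  idx := s.idx
  num := fun a i j k =>
    if a = c.arr ∧ i = s.idx c.i ∧ j = s.idx c.j ∧ k = s.idx c.k then x else s.num a i j k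

/-- Overwrite the content of an index register. -/
def Memory.setIdx {K : Type} (s : Memory K) (r v : ℕ) : Memory K where
  idx := fun q => if q = r then v else s.idx q
  num := s.num

/-- The result of an arithmetic operation. A division by zero returns `0`. -/
def Op.eval {K : Type} [Field K] : Op → K → K → K
  | .add, x, y => x + y
  | .sub, x, y => x - y
  | .mul, x, y => x * y
  | .div, x, y => x / y

/-- The outcome of a test. -/
def Test.eval {K : Type} [LinearOrder K] (s : Memory K) : Test → Bool
  | .idxLt q r => decide (s.idx q < s.idx r)
  | .numLe a b => decide (s.read a ≤ s.read b)

/-- A configuration: the pieces of program that are still to be executed, in this order, and the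
memory. The machine has halted when nothing is left to be executed. -/
structure Config (K : Type) where
  todo : List Program
  mem : Memory K

/-- One step of the machine. A halted configuration does not change. -/
def step {K : Type} [Field K] [LinearOrder K] : Config K → Config K
  | ⟨[], s⟩ => ⟨[], s⟩
  | ⟨.skip :: l, s⟩ => ⟨l, s⟩
  | ⟨.idxZero r :: l, s⟩ => ⟨l, s.setIdx r 0⟩
  | ⟨.idxSucc r :: l, s⟩ => ⟨l, s.setIdx r (s.idx r + 1)⟩
  | ⟨.idxCopy r q :: l, s⟩ => ⟨l, s.setIdx r (s.idx q)⟩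
  | ⟨.const c z :: l, s⟩ => ⟨l, s.write c (z : K)⟩
  | ⟨.copy c a :: l, s⟩ => ⟨l, s.write c (s.read a)⟩
  | ⟨.arith o c a b :: l, s⟩ => ⟨l, s.write c (o.eval (s.read a) (s.read b))⟩
  | ⟨.seq P Q :: l, s⟩ => ⟨P :: Q :: l, s⟩
  | ⟨.ite b P Q :: l, s⟩ => ⟨(if b.eval s then P else Q) :: l, s⟩
  | ⟨.while b P :: l, s⟩ => ⟨if b.eval s then P :: .while b P :: l else l, s⟩

/-- The configuration after `t` steps of the program `P`, started on the memory `s`. -/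
def run {K : Type} [Field K] [LinearOrder K] (P : Program) (s : Memory K) (t : ℕ) : Config K :=
  step^[t] ⟨[P], s⟩

/-- The memory that holds the homogeneous cubic `f` in `n` variables as input: index register `0`
holds `n`, the cell of array `0` at position `(i, j, k)` with `i, j, k < n` holds the coefficient of
the monomial `x_i x_j x_k` in `f`, and everything else is `0`. -/
noncomputable def cubicInput {K : Type} [Field K] {n : ℕ} (f : MvPolynomial (Fin n) K) : Memory K where
  idx := fun r => if r = 0 then n else 0
  num := fun a i j k =>
    if h : a = 0 ∧ i < n ∧ j < n ∧ k < n then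
      f.coeff (Finsupp.single ⟨i, h.2.1⟩ 1 + Finsupp.single ⟨j, h.2.2.1⟩ 1
        + Finsupp.single ⟨k, h.2.2.2⟩ 1)
    else 0

/-- Within `T` steps on the memory `s`, the program `P` halts, leaving in index register `1` the
answer to the question whether `A` holds: `1` for yes, `0` for no. -/
def AnswersWithin {K : Type} [Field K] [LinearOrder K] (P : Program) (s : Memory K) (T : ℕ)
    (A : Prop) : Prop :=
  (run P s T).todo = [] ∧
    (A → (run P s T).mem.idx 1 = 1) ∧ (¬ A → (run P s T).mem.idx 1 = 0)

end ArithRAM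

/-- The bit length of a rational number: that of its numerator plus that of its denominator, in
lowest terms (up to the sign bit). -/
def bitLength (q : ℚ) : ℕ := q.num.natAbs.size + q.den.size

/-- The size of a polynomial with rational coefficients: the number of variables plus the bit
lengths of its nonzero coefficients. -/
noncomputable def inputSize {n : ℕ} (f : MvPolynomial (Fin n) ℚ) : ℕ :=
  n + ∑ m ∈ f.support, bitLength (f.coeff m)

/-!
A homogeneous cubic `f` is determined by its third partial derivatives `a i j k`, and Euler's identity
gives `6 f(x) = T(x, x, x)` for the symmetric trilinear form `T` with these coefficients. Restricting
`log f` to lines shows that `f` is log concave iff the reversed Cauchy–Schwarz inequality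
`T(x, h, h) T(x, x, x) ≤ T(x, x, h)²` holds for all `h` and all positive `x`
(`isLogConcave_iff_hessian`), that is, iff the Hessian of `f` has at most one positive eigenvalue at
positive points.

These infinitely many conditions reduce to `n + 1` of them (`hessian_iff_slices`): the Hessians of
the quadratic forms `∂_k f`, and the Hessian of `f` at `(1, …, 1)`, must have at most one positive
eigenvalue. Necessity is a limit argument. For sufficiency, let `H` be the Hessian at `x`, and `D` the
diagonal matrix with the entries `(H x)_i / x_i`. The conditions on the `∂_k f` add up to
`H ≤ H D⁻¹ H`, and `D - H` is a weighted graph Laplacian, so `H ≤ D`. Hence a positive eigenvalue of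
`D^{-1/2} H D^{-1/2}` equals `1`, and its eigenvectors come from vectors that are proportional to `x`
on each connected component of the graph of pairs of variables that share a monomial. The condition
at `(1, …, 1)` forces this graph to be connected (up to variables that do not occur), by the equality
case of Cauchy–Schwarz, so that there is only one positive eigenvalue.

A symmetric matrix `A` with nonnegative entries has at most one positive eigenvalue iff
`(A 1)(A 1)ᵀ - (1ᵀ A 1) A` is positive semidefinite, and this is tested by elimination without
pivoting: with the convention `x / 0 = 0`, a symmetric matrix is positive semidefinite iff all pivots
are nonnegative and nothing is left at the end (`quadForm_nonneg_iff_eliminationPasses`). This is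
`O(n³)` arithmetic operations for each of the `n + 1` matrices. The criterion `Accepts` uses field
operations and the order only, so that it has the same truth value over `ℚ` and over `ℝ`.

The program is verified in a logic of weakest preconditions (`ArithRAM.Wp`) that bounds the time and
keeps a property `G` of all numbers in the memory. Over `ℝ` this property is trivial; over `ℚ` it is
a bound for the size. The bound holds for each stage of the elimination, also if the matrix is not
positive semidefinite and the result is meaningless, because the entries of all stages are quotients
of minors (`exists_eliminate_eq_div`): steps with a zero pivot change nothing, and the other pivots
form the principal minor in the denominator.
-/

/-! ### Symmetric trilinear forms -/

/-- The trilinear form with coefficients `a`. -/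
def triForm {n : ℕ} (a : Fin n → Fin n → Fin n → ℝ) (x y z : Fin n → ℝ) : ℝ :=
  ∑ i, ∑ j, ∑ k, a i j k * x i * y j * z k

section TriForm

variable {n : ℕ} {a : Fin n → Fin n → Fin n → ℝ}

theorem triForm_add_right (x y z w : Fin n → ℝ) :
    triForm a x y (z + w) = triForm a x y z + triForm a x y w := by
  simp [triForm, mul_add, Finset.sum_add_distrib]

theorem triForm_smul_right (c : ℝ) (x y z : Fin n → ℝ) :
    triForm a x y (c • z) = c * triForm a x y z := by
  simp only [triForm, Finset.mul_sum, Pi.smul_apply, smul_eq_mul]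
  refine Finset.sum_congr rfl fun i _ => Finset.sum_congr rfl fun j _ =>
    Finset.sum_congr rfl fun k _ => by ring

theorem triForm_swap_left (h : ∀ i j k, a i j k = a j i k) (x y z : Fin n → ℝ) :
    triForm a x y z = triForm a y x z := by
  unfold triForm
  rw [Finset.sum_comm]
  refine Finset.sum_congr rfl fun i _ => Finset.sum_congr rfl fun j _ =>
    Finset.sum_congr rfl fun k _ => ?_
  rw [h j i k]
  ring

theorem triForm_swap_right (h : ∀ i j k, a i j k = a i k j) (x y z : Fin n → ℝ) :
    triForm a x y z = triForm a x z y := by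
  unfold triForm
  refine Finset.sum_congr rfl fun i _ => ?_
  rw [Finset.sum_comm]
  refine Finset.sum_congr rfl fun j _ => Finset.sum_congr rfl fun k _ => ?_
  rw [h i k j]
  ring

theorem triForm_nonneg (h : ∀ i j k, 0 ≤ a i j k) {x y z : Fin n → ℝ} (hx : ∀ i, 0 ≤ x i)
    (hy : ∀ i, 0 ≤ y i) (hz : ∀ i, 0 ≤ z i) : 0 ≤ triForm a x y z :=
  Finset.sum_nonneg fun i _ => Finset.sum_nonneg fun j _ => Finset.sum_nonneg fun k _ =>
    mul_nonneg (mul_nonneg (mul_nonneg (h i j k) (hx i)) (hy j)) (hz k)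

theorem continuous_triForm {X : Type*} [TopologicalSpace X] {x y z : X → Fin n → ℝ}
    (hx : Continuous x) (hy : Continuous y) (hz : Continuous z) :
    Continuous fun t => triForm a (x t) (y t) (z t) := by
  unfold triForm
  fun_prop

/-- Expansion of the form along a line, with the last two arguments moving. -/
theorem triForm_line_right (h23 : ∀ i j k, a i j k = a i k j) (x y h : Fin n → ℝ) (t : ℝ) :
    triForm a x (y + t • h) (y + t • h)
      = triForm a x y y + 2 * t * triForm a x y h + t ^ 2 * triForm a x h h := by
  rw [triForm_add_right, triForm_smul_right, triForm_swap_right h23 x _ y,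
    triForm_swap_right h23 x _ h, triForm_add_right, triForm_smul_right, triForm_add_right,
    triForm_smul_right, triForm_swap_right h23 x h y]
  ring

variable (h12 : ∀ i j k, a i j k = a j i k) (h23 : ∀ i j k, a i j k = a i k j)
include h12 h23

theorem triForm_line_one (x h u v : Fin n → ℝ) (t : ℝ) :
    triForm a (x + t • h) u v = triForm a x u v + t * triForm a h u v := by
  have e : ∀ w, triForm a w u v = triForm a u v w := fun w => by
    rw [triForm_swap_left h12, triForm_swap_right h23]
  rw [e, e, e, triForm_add_right, triForm_smul_right]

theorem triForm_line_two (x h : Fin n → ℝ) (t : ℝ) :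
    triForm a (x + t • h) (x + t • h) h
      = triForm a x x h + 2 * t * triForm a x h h + t ^ 2 * triForm a h h h := by
  have e : ∀ w, triForm a w w h = triForm a h w w := fun w => by
    rw [triForm_swap_right h23, triForm_swap_left h12]
  rw [e, triForm_line_right h23, e x, e h, triForm_swap_left h12 h x h]

theorem triForm_line_three (x h : Fin n → ℝ) (t : ℝ) :
    triForm a (x + t • h) (x + t • h) (x + t • h)
      = triForm a x x x + 3 * t * triForm a x x h + 3 * t ^ 2 * triForm a x h h
        + t ^ 3 * triForm a h h h := by
  rw [triForm_line_one h12 h23, triForm_line_right h23, triForm_line_right h23,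
    triForm_swap_left h12 h x x, triForm_swap_right h23 x h x, triForm_swap_left h12 h x h]
  ring

end TriForm

/-! ### Hyperbolic quadratic forms -/

/-- Let `B` be a symmetric bilinear form, and let the arguments be its values on pairs of vectors
among `v`, `w`, `h`. If the reversed Cauchy–Schwarz inequality holds against the vector `v`, where
`B v v > 0`, for the vectors `w` and `B(v,h) w - B(v,w) h`, then it holds for `w` and `h`, provided
that `B w w ≥ 0`: otherwise `B` would be positive definite on the span of `w` and `h`, which meets
the orthogonal complement of `v`. -/
theorem reverse_cauchySchwarz_transfer {vv vw vh ww wh hh : ℝ} (hv : 0 < vv) (hw : 0 ≤ ww)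
    (h1 : ww * vv ≤ vw ^ 2) (h2 : vh ^ 2 * ww - 2 * vh * vw * wh + vw ^ 2 * hh ≤ 0) :
    hh * ww ≤ wh ^ 2 := by
  by_contra! hlt
  have hww : 0 < ww := by
    rcases hw.eq_or_lt with h | h
    · subst h
      nlinarith [sq_nonneg wh]
    · exact h
  have hvw : vw ^ 2 * (hh * ww - wh ^ 2) ≤ 0 := by
    nlinarith [sq_nonneg (ww * vh - vw * wh), mul_nonneg hww.le (neg_nonneg.2 h2)]
  have : 0 < vw ^ 2 := lt_of_lt_of_le (mul_pos hww hv) h1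
  nlinarith [mul_pos this (sub_pos.2 hlt)]

section TriForm

variable {n : ℕ} {a : Fin n → Fin n → Fin n → ℝ}

/-- The Hessian `B = triForm a x` with the reversed Cauchy–Schwarz inequality against `v`. -/
theorem reverse_cauchySchwarz_of_pos (h23 : ∀ i j k, a i j k = a i k j) {x v w : Fin n → ℝ}
    (hv : 0 < triForm a x v v)
    (hrev : ∀ h, triForm a x h h * triForm a x v v ≤ triForm a x v h ^ 2)
    (hw : 0 ≤ triForm a x w w) (h : Fin n → ℝ) :
    triForm a x h h * triForm a x w w ≤ triForm a x w h ^ 2 := by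
  refine reverse_cauchySchwarz_transfer hv hw (hrev w) (vh := triForm a x v h) ?_
  have := hrev (triForm a x v h • w + (-triForm a x v w) • h)
  have e : ∀ (c : ℝ) (u z : Fin n → ℝ), triForm a x (c • u) z = c * triForm a x u z := fun c u z => by
    rw [triForm_swap_right h23, triForm_smul_right, triForm_swap_right h23]
  rw [triForm_line_right h23, e, e, triForm_smul_right, triForm_add_right,
    triForm_smul_right, triForm_smul_right] at this
  have h0 : triForm a x v h * triForm a x v w + -triForm a x v w * triForm a x v h = 0 := by ring
  rw [h0, zero_pow two_ne_zero] at this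
  have := nonpos_of_mul_nonpos_left this hv
  linarith

end TriForm

/-! ### Log concavity in terms of the Hessian -/

/-- The third partial derivative `∂_i ∂_j ∂_k f` of a homogeneous cubic, read off from the
coefficient of `x_i x_j x_k`. -/
noncomputable def thirdPartial {n : ℕ} {K : Type*} [Field K] (f : MvPolynomial (Fin n) K) (i j k : Fin n) : K :=
  (1 + if i = j then 1 else 0) * (1 + (if i = k then 1 else 0) + if j = k then 1 else 0) *
    f.coeff (Finsupp.single i 1 + Finsupp.single j 1 + Finsupp.single k 1)

theorem thirdPartial_swap_left {n : ℕ} {K : Type*} [Field K] (f : MvPolynomial (Fin n) K)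
    (i j k : Fin n) : thirdPartial f i j k = thirdPartial f j i k := by
  unfold thirdPartial
  rw [add_comm (Finsupp.single i 1)]
  simp only [eq_comm (a := i) (b := j)]
  ring

theorem thirdPartial_swap_right {n : ℕ} {K : Type*} [Field K] (f : MvPolynomial (Fin n) K)
    (i j k : Fin n) : thirdPartial f i j k = thirdPartial f i k j := by
  unfold thirdPartial
  rw [add_right_comm (Finsupp.single i 1)]
  by_cases hij : i = j <;> by_cases hik : i = k <;> by_cases hjk : j = k <;>
    simp_all [eq_comm]

theorem thirdPartial_nonneg {n : ℕ} {f : MvPolynomial (Fin n) ℝ} (hf : ∀ m, 0 ≤ f.coeff m)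
    (i j k : Fin n) : 0 ≤ thirdPartial f i j k := by
  unfold thirdPartial
  have := hf (Finsupp.single i 1 + Finsupp.single j 1 + Finsupp.single k 1)
  positivity

theorem thirdPartial_eq_coeff_pderiv {n : ℕ} {K : Type*} [Field K] (f : MvPolynomial (Fin n) K)
    (i j k : Fin n) :
    thirdPartial f i j k
      = (MvPolynomial.pderiv i (MvPolynomial.pderiv j (MvPolynomial.pderiv k f))).coeff 0 := by
  simp only [MvPolynomial.coeff_pderiv, thirdPartial]
  simp [Finsupp.single_apply]
  ring

/-- Euler's identity, used three times. -/
theorem six_mul_eval_eq_triForm {n : ℕ} {f : MvPolynomial (Fin n) ℝ} (hf : f.IsHomogeneous 3)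
    (x : Fin n → ℝ) : 6 * MvPolynomial.eval x f = triForm (thirdPartial f) x x x := by
  have h3 := congrArg (MvPolynomial.eval x) hf.sum_X_mul_pderiv
  have h2 := fun k => congrArg (MvPolynomial.eval x) (hf.pderiv (i := k)).sum_X_mul_pderiv
  have h1 := fun k j =>
    congrArg (MvPolynomial.eval x) ((hf.pderiv (i := k)).pderiv (i := j)).sum_X_mul_pderiv
  have h0 : ∀ i j k, MvPolynomial.eval x
      (MvPolynomial.pderiv i (MvPolynomial.pderiv j (MvPolynomial.pderiv k f)))
        = thirdPartial f i j k := fun i j k => by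
    have h := ((hf.pderiv (i := k)).pderiv (i := j)).pderiv (i := i)
    rw [thirdPartial_eq_coeff_pderiv]
    have h' := MvPolynomial.totalDegree_eq_zero_iff_eq_C.1
      (Nat.le_zero.1 (h.totalDegree_le))
    conv_lhs => rw [h']
    simp
  simp only [map_sum, map_mul, MvPolynomial.eval_X, nsmul_eq_mul, h0] at h1 h2 h3
  norm_num at h1 h2 h3
  have : 6 * MvPolynomial.eval x f = 2 * (3 * MvPolynomial.eval x f) := by ring
  rw [this, ← h3, Finset.mul_sum]
  have : triForm (thirdPartial f) x x x
      = ∑ k, ∑ j, ∑ i, thirdPartial f i j k * x i * x j * x k := by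
    unfold triForm
    refine Finset.sum_congr rfl fun i _ => Finset.sum_congr rfl fun j _ =>
      Finset.sum_congr rfl fun k _ => ?_
    rw [thirdPartial_swap_left, thirdPartial_swap_right, thirdPartial_swap_left]
    ring
  rw [this]
  refine Finset.sum_congr rfl fun k _ => ?_
  rw [mul_left_comm, ← h2 k, Finset.mul_sum]
  refine Finset.sum_congr rfl fun j _ => ?_
  rw [← h1 k j, Finset.mul_sum, Finset.mul_sum]
  refine Finset.sum_congr rfl fun i _ => by ring

theorem isLogConcave_zero {n : ℕ} : IsLogConcave (0 : MvPolynomial (Fin n) ℝ) := by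
  simp only [IsLogConcave, map_zero, Real.log_zero]
  refine concaveOn_const 0 fun x hx y hy a b ha hb hab i => ?_
  have hx := hx i
  have hy := hy i
  simp only [Pi.add_apply, Pi.smul_apply, smul_eq_mul]
  rcases ha.eq_or_lt with rfl | ha
  · rw [zero_add] at hab
    simpa [hab] using hy
  · positivity

theorem triForm_thirdPartial_pos {n : ℕ} {f : MvPolynomial (Fin n) ℝ} (hf : f.IsHomogeneous 3)
    (hc : ∀ m, 0 ≤ f.coeff m) (h0 : f ≠ 0) {x : Fin n → ℝ} (hx : ∀ i, 0 < x i) :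
    0 < triForm (thirdPartial f) x x x := by
  rw [← six_mul_eval_eq_triForm hf]
  have := eval_pos_of_coeff_nonneg hc h0 hx
  positivity

/-- Along `x + t g` with `∂_g f = 0` at `x`, the polynomial is `f(x) + b t² / 2 + O(t³)`, so that
midpoint concavity of `log f` forces `b ≤ 0`. -/
theorem hessian_nonpos_of_isLogConcave {n : ℕ} {f : MvPolynomial (Fin n) ℝ}
    (hf : f.IsHomogeneous 3) (hc : ∀ m, 0 ≤ f.coeff m) (h0 : f ≠ 0) (hlog : IsLogConcave f)
    {x g : Fin n → ℝ} (hx : ∀ i, 0 < x i) (hg : triForm (thirdPartial f) x x g = 0) :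
    triForm (thirdPartial f) x g g ≤ 0 := by
  set a := thirdPartial f
  by_contra! hb
  set b := triForm a x g g
  set c := triForm a g g g
  have hcx := triForm_thirdPartial_pos hf hc h0 hx
  have ev1 : ∀ᶠ t : ℝ in nhdsWithin 0 (Set.Ioi 0), ∀ i, 0 < x i + t * g i := by
    refine Filter.eventually_all.2 fun i => nhdsWithin_le_nhds ?_
    have : Continuous fun t : ℝ => x i + t * g i := by fun_prop
    exact this.continuousAt.eventually (lt_mem_nhds (by simpa using hx i))
  have ev2 : ∀ᶠ t : ℝ in nhdsWithin 0 (Set.Ioi 0), ∀ i, 0 < x i + (-t) * g i := by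
    refine Filter.eventually_all.2 fun i => nhdsWithin_le_nhds ?_
    have : Continuous fun t : ℝ => x i + (-t) * g i := by fun_prop
    exact this.continuousAt.eventually (lt_mem_nhds (by simpa using hx i))
  have ev3 : ∀ᶠ t : ℝ in nhdsWithin 0 (Set.Ioi 0), c ^ 2 * t ^ 2 < 9 * b ^ 2 := by
    refine nhdsWithin_le_nhds ?_
    have : Continuous fun t : ℝ => c ^ 2 * t ^ 2 := by fun_prop
    exact this.continuousAt.eventually (gt_mem_nhds (by simp; positivity))
  obtain ⟨t, ht1, ht2, ht3, ht⟩ :=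
    (ev1.and (ev2.and (ev3.and self_mem_nhdsWithin))).exists
  have ht : 0 < t := ht
  have hp1 : ∀ i, 0 < (x + t • g) i := by simpa using ht1
  have hp2 : ∀ i, 0 < (x + (-t) • g) i := by simpa using ht2
  have h1 := triForm_line_three (thirdPartial_swap_left f) (thirdPartial_swap_right f) x g t
  have h2 := triForm_line_three (thirdPartial_swap_left f) (thirdPartial_swap_right f) x g (-t)
  rw [← six_mul_eval_eq_triForm hf] at h1 h2 hcx
  have hmid := hlog.2
  have hmid := hmid hp1 hp2 (one_half_pos (α := ℝ)).le (one_half_pos (α := ℝ)).le (add_halves 1)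
  have hxx : (1 / 2 : ℝ) • (x + t • g) + (1 / 2 : ℝ) • (x + (-t) • g) = x := by module
  have q1 := eval_pos_of_coeff_nonneg hc h0 hp1
  have q2 := eval_pos_of_coeff_nonneg hc h0 hp2
  have q0 := eval_pos_of_coeff_nonneg hc h0 hx
  simp only [hxx, smul_eq_mul] at hmid
  set F := MvPolynomial.eval x f
  set F1 := MvPolynomial.eval (x + t • g) f
  set F2 := MvPolynomial.eval (x + (-t) • g) f
  have hle : F1 * F2 ≤ F ^ 2 := by
    refine (Real.log_le_log_iff (mul_pos q1 q2) (by positivity)).1 ?_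
    rw [Real.log_mul q1.ne' q2.ne', Real.log_pow]
    push_cast
    linarith
  change _ = _ + 3 * t * triForm a x x g + 3 * t ^ 2 * b + t ^ 3 * c at h1
  change _ = _ + 3 * (-t) * triForm a x x g + 3 * (-t) ^ 2 * b + (-t) ^ 3 * c at h2
  rw [← six_mul_eval_eq_triForm hf, hg] at h1 h2
  have e : 36 * (F1 * F2) = 36 * F ^ 2 + 36 * F * b * t ^ 2
      + t ^ 4 * (9 * b ^ 2 - c ^ 2 * t ^ 2) := by
    calc 36 * (F1 * F2) = (6 * F1) * (6 * F2) := by ring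
      _ = _ := by rw [h1, h2]; ring
  have : 0 < 36 * F * b * t ^ 2 := by positivity
  have : 0 < t ^ 4 * (9 * b ^ 2 - c ^ 2 * t ^ 2) := mul_pos (by positivity) (by linarith)
  linarith

/-- Along a segment `x + t h`, the cubic `F` and its derivatives satisfy
`6 F F'' = T(p,p,p) T(p,h,h) ≤ T(p,p,h)² = 4 F'²`, hence `(log F)'' ≤ 0`. -/
theorem isLogConcave_of_hessian {n : ℕ} {f : MvPolynomial (Fin n) ℝ}
    (hf : f.IsHomogeneous 3) (hc : ∀ m, 0 ≤ f.coeff m) (h0 : f ≠ 0)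
    (hH : ∀ x : Fin n → ℝ, (∀ i, 0 < x i) → ∀ h, triForm (thirdPartial f) x h h *
      triForm (thirdPartial f) x x x ≤ triForm (thirdPartial f) x x h ^ 2) : IsLogConcave f := by
  have hconv : Convex ℝ {x : Fin n → ℝ | ∀ i, 0 < x i} := (isLogConcave_zero (n := n)).1
  refine ⟨hconv, fun x hx y hy α β hα hβ hαβ => ?_⟩
  set a := thirdPartial f
  have s12 := thirdPartial_swap_left f
  have s23 := thirdPartial_swap_right f
  set h := y - x
  have hp : ∀ t ∈ Set.Icc (0 : ℝ) 1, ∀ i, 0 < (x + t • h) i := by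
    rintro t ⟨ht0, ht1⟩
    have : x + t • h = (1 - t) • x + t • y := by
      simp only [h]
      module
    rw [this]
    exact hconv hx hy (by linarith) ht0 (by ring)
  have key : ConcaveOn ℝ (Set.Icc (0 : ℝ) 1)
      (fun t => Real.log (triForm a (x + t • h) (x + t • h) (x + t • h))) := by
    have hF : ∀ t, HasDerivAt (fun t : ℝ => triForm a (x + t • h) (x + t • h) (x + t • h))
        (3 * triForm a (x + t • h) (x + t • h) h) t := by
      intro t
      simp only [a, triForm_line_three s12 s23, triForm_line_two s12 s23]
      exact ((((hasDerivAt_const t (triForm a x x x)).fun_add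
        (((hasDerivAt_id' t).const_mul 3).mul_const (triForm a x x h))).fun_add
        (((hasDerivAt_pow 2 t).const_mul 3).mul_const (triForm a x h h))).fun_add
        ((hasDerivAt_pow 3 t).mul_const (triForm a h h h))).congr_deriv (by push_cast; ring)
    have hF' : ∀ t, HasDerivAt (fun t : ℝ => 3 * triForm a (x + t • h) (x + t • h) h)
        (6 * triForm a (x + t • h) h h) t := by
      intro t
      rw [triForm_line_one s12 s23]
      simp only [a, triForm_line_two s12 s23]
      exact ((((hasDerivAt_const t (triForm a x x h)).fun_add
        (((hasDerivAt_id' t).const_mul 2).mul_const (triForm a x h h))).fun_add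
        ((hasDerivAt_pow 2 t).mul_const (triForm a h h h))).const_mul 3).congr_deriv
          (by push_cast; ring)
    have hpos : ∀ t ∈ Set.Icc (0 : ℝ) 1,
        0 < triForm a (x + t • h) (x + t • h) (x + t • h) := fun t ht =>
      triForm_thirdPartial_pos hf hc h0 (hp t ht)
    refine concaveOn_of_hasDerivWithinAt2_nonpos (convex_Icc 0 1) (fun t ht => ?_)
      (fun t ht => ((hF t).log (hpos t (interior_subset ht)).ne').hasDerivWithinAt)
      (fun t ht => ((hF' t).div (hF t) (hpos t (interior_subset ht)).ne').hasDerivWithinAt) ?_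
    · exact ((hF t).continuousAt.log (hpos t ht).ne').continuousWithinAt
    · intro t ht
      have hp' := hpos t (interior_subset ht)
      refine div_nonpos_of_nonpos_of_nonneg ?_ (sq_nonneg _)
      have := hH _ (hp t (interior_subset ht)) h
      nlinarith [sq_nonneg (triForm a (x + t • h) (x + t • h) h)]
  have h2 := key.2 (Set.left_mem_Icc.2 zero_le_one) (Set.right_mem_Icc.2 zero_le_one) hα hβ hαβ
  have hx1 : x + (1 : ℝ) • h = y := by simp [h]
  have hxy : x + β • h = α • x + β • y := by
    obtain rfl : α = 1 - β := by linarith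
    simp only [h]
    module
  have hlog : ∀ z : Fin n → ℝ, (∀ i, 0 < z i) →
      Real.log (triForm a z z z) = Real.log 6 + Real.log (MvPolynomial.eval z f) := fun z hz => by
    rw [← six_mul_eval_eq_triForm hf,
      Real.log_mul (by norm_num) (eval_pos_of_coeff_nonneg hc h0 hz).ne']
  simp only [smul_eq_mul, mul_zero, mul_one, zero_add, zero_smul, add_zero, hx1, hxy] at h2
  rw [hlog x hx, hlog y hy, hlog _ (hconv hx hy hα hβ hαβ)] at h2
  simp only [smul_eq_mul]
  obtain rfl : α = 1 - β := by linarith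
  linarith

theorem isLogConcave_iff_hessian {n : ℕ} {f : MvPolynomial (Fin n) ℝ}
    (hf : f.IsHomogeneous 3) (hc : ∀ m, 0 ≤ f.coeff m) :
    IsLogConcave f ↔ ∀ x : Fin n → ℝ, (∀ i, 0 < x i) → ∀ h, triForm (thirdPartial f) x h h *
      triForm (thirdPartial f) x x x ≤ triForm (thirdPartial f) x x h ^ 2 := by
  by_cases h0 : f = 0
  · subst h0
    exact iff_of_true isLogConcave_zero fun x hx h => by simp [triForm, thirdPartial]
  refine ⟨fun hlog x hx h => ?_, isLogConcave_of_hessian hf hc h0⟩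
  have hpos := triForm_thirdPartial_pos hf hc h0 hx
  have s12 := thirdPartial_swap_left f
  have s23 := thirdPartial_swap_right f
  set T := triForm (thirdPartial f)
  -- `h - u x` is the component of `h` on which the gradient at `x` vanishes
  set u := T x x h / T x x x
  have hu : u * T x x x = T x x h := div_mul_cancel₀ _ hpos.ne'
  have h1 : T x x (h + (-u) • x) = 0 := by
    simp only [T, triForm_add_right, triForm_smul_right]
    change T x x h + -u * T x x x = 0
    linarith
  have h2 := hessian_nonpos_of_isLogConcave hf hc h0 hlog hx h1
  rw [triForm_line_right s23, triForm_swap_right s23 x h x] at h2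
  change T x h h + 2 * -u * T x x h + (-u) ^ 2 * T x x x ≤ 0 at h2
  have h3 : T x h h ≤ u * T x x h := by
    rw [← hu] at h2 ⊢
    linarith
  calc T x h h * T x x x ≤ u * T x x h * T x x x := mul_le_mul_of_nonneg_right h3 hpos.le
    _ = T x x h ^ 2 := by rw [mul_right_comm, hu]; ring

/-! ### Hyperbolicity of the coordinate slices suffices -/

/-- A symmetric matrix is nonpositive at a vector orthogonal to the eigenvectors for the positive
eigenvalues. -/
theorem dotProduct_mulVec_nonpos_of_eigenvectors {n : ℕ} {B : Matrix (Fin n) (Fin n) ℝ}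
    (hB : B.IsHermitian) {z : Fin n → ℝ}
    (h : ∀ (b : Fin n → ℝ) (l : ℝ), b ≠ 0 → B.mulVec b = l • b → l ≤ 0 ∨ dotProduct b z = 0) :
    dotProduct z (B.mulVec z) ≤ 0 := by
  have key := hB.eigenvectorBasis.sum_inner_mul_inner (WithLp.toLp 2 z)
    (WithLp.toLp 2 (B.mulVec z))
  simp only [EuclideanSpace.inner_eq_star_dotProduct, star_trivial] at key
  rw [dotProduct_comm, ← key]
  refine Finset.sum_nonpos fun l _ => ?_
  have hb := hB.mulVec_eigenvectorBasis l
  set b : Fin n → ℝ := (hB.eigenvectorBasis l).ofLp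
  have e : dotProduct (B.mulVec z) b = hB.eigenvalues l * dotProduct b z := by
    rw [dotProduct_comm, Matrix.dotProduct_mulVec, ← Matrix.mulVec_transpose]
    have : B.transpose = B := by simpa [Matrix.IsHermitian] using hB
    rw [this, hb, smul_dotProduct, smul_eq_mul]
  have hne : b ≠ 0 := fun h0 => by
    have h1 := hB.eigenvectorBasis.orthonormal.ne_zero l
    exact h1 (by ext i; exact congrFun h0 i)
  rw [e, mul_left_comm]
  rcases h b _ hne hb with h1 | h1
  · exact mul_nonpos_of_nonpos_of_nonneg h1 (mul_self_nonneg _)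
  · simp [h1]

/-- Equality in the Cauchy–Schwarz inequality for the weights `r`. -/
theorem eq_of_sum_mul_sq_le {n : ℕ} {r u : Fin n → ℝ} (hr : ∀ i, 0 ≤ r i)
    (h : (∑ i, r i * u i ^ 2) * ∑ i, r i ≤ (∑ i, r i * u i) ^ 2) {i j : Fin n} (hi : 0 < r i)
    (hj : 0 < r j) : u i = u j := by
  have e : ∑ i, ∑ j, r i * r j * (u i - u j) ^ 2
      = 2 * ((∑ i, r i * u i ^ 2) * ∑ i, r i) - 2 * (∑ i, r i * u i) ^ 2 := by
    have h1 : ∀ i j, r i * r j * (u i - u j) ^ 2 = (r i * u i ^ 2) * r j + r i * (r j * u j ^ 2)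
        - 2 * ((r i * u i) * (r j * u j)) := fun i j => by ring
    simp only [h1, Finset.sum_add_distrib, Finset.sum_sub_distrib, ← Finset.mul_sum,
      ← Finset.sum_mul]
    ring
  have h2 : ∀ i j, 0 ≤ r i * r j * (u i - u j) ^ 2 := fun i j =>
    mul_nonneg (mul_nonneg (hr i) (hr j)) (sq_nonneg _)
  have h3 : r i * r j * (u i - u j) ^ 2 ≤ 0 := by
    calc r i * r j * (u i - u j) ^ 2 ≤ ∑ j, r i * r j * (u i - u j) ^ 2 :=
          Finset.single_le_sum (f := fun j => r i * r j * (u i - u j) ^ 2)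
            (fun j _ => h2 i j) (Finset.mem_univ j)
      _ ≤ ∑ i, ∑ j, r i * r j * (u i - u j) ^ 2 :=
          Finset.single_le_sum (f := fun i => ∑ j, r i * r j * (u i - u j) ^ 2)
            (fun i _ => Finset.sum_nonneg fun j _ => h2 i j) (Finset.mem_univ i)
      _ ≤ 0 := by rw [e]; linarith
  have h4 : (u i - u j) ^ 2 ≤ 0 := by
    by_contra! hlt
    exact absurd h3 (not_le.2 (mul_pos (mul_pos hi hj) hlt))
  have := pow_eq_zero_iff two_ne_zero |>.1 (le_antisymm h4 (sq_nonneg _))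
  linarith

section Sufficiency

variable {n : ℕ} {a : Fin n → Fin n → Fin n → ℝ}

/-- The matrix of the quadratic form `z ↦ triForm a x z z`. -/
def hessianMatrix (a : Fin n → Fin n → Fin n → ℝ) (x : Fin n → ℝ) : Matrix (Fin n) (Fin n) ℝ :=
  Matrix.of fun i j => ∑ k, a k i j * x k

theorem triForm_eq_dotProduct (x y z : Fin n → ℝ) :
    triForm a x y z = dotProduct y ((hessianMatrix a x).mulVec z) := by
  simp only [triForm, dotProduct, Matrix.mulVec, hessianMatrix, Matrix.of_apply, Finset.mul_sum,
    Finset.sum_mul]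
  rw [Finset.sum_comm]
  refine Finset.sum_congr rfl fun i _ => ?_
  rw [Finset.sum_comm]
  refine Finset.sum_congr rfl fun j _ => Finset.sum_congr rfl fun k _ => by ring

theorem triForm_single_left (k : Fin n) (y z : Fin n → ℝ) :
    triForm a (Pi.single k 1) y z = ∑ i, ∑ j, a k i j * y i * z j := by
  unfold triForm
  rw [Finset.sum_eq_single k]
  · simp
  · intro b _ hb
    simp [hb]
  · simp

theorem triForm_eq_sum_single (x y z : Fin n → ℝ) :
    triForm a x y z = ∑ k, x k * triForm a (Pi.single k 1) y z := by
  simp only [triForm_single_left, Finset.mul_sum]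
  unfold triForm
  refine Finset.sum_congr rfl fun i _ => Finset.sum_congr rfl fun j _ =>
    Finset.sum_congr rfl fun k _ => by ring

theorem triForm_single_eq_mulVec (h12 : ∀ i j k, a i j k = a j i k) (k : Fin n)
    (x z : Fin n → ℝ) :
    triForm a (Pi.single k 1) x z = (hessianMatrix a x).mulVec z k := by
  rw [triForm_swap_left h12, triForm_eq_dotProduct, single_one_dotProduct]

theorem slice_eq_zero_of_triForm_eq_zero (h0 : ∀ i j k, 0 ≤ a i j k) {k : Fin n}
    {x y : Fin n → ℝ} (hx : ∀ i, 0 < x i) (hy : ∀ i, 0 < y i)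
    (h : triForm a (Pi.single k 1) x y = 0) (i j : Fin n) : a k i j = 0 := by
  rw [triForm_single_left] at h
  have nn : ∀ i j, 0 ≤ a k i j * x i * y j := fun i j =>
    mul_nonneg (mul_nonneg (h0 k i j) (hx i).le) (hy j).le
  have h1 := (Finset.sum_eq_zero_iff_of_nonneg fun i _ => Finset.sum_nonneg fun j _ => nn i j).1 h
    i (Finset.mem_univ i)
  have h2 := (Finset.sum_eq_zero_iff_of_nonneg fun j _ => nn i j).1 h1 j (Finset.mem_univ j)
  simpa [(hx i).ne', (hy j).ne'] using h2

/-- The degree matrix minus the adjacency matrix: a weighted graph Laplacian. -/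
theorem sum_div_mul_sq_sub_eq_laplacian (h23 : ∀ i j k, a i j k = a i k j) {x : Fin n → ℝ}
    (hx : ∀ i, 0 < x i) (z : Fin n → ℝ) :
    2 * (∑ i, (hessianMatrix a x).mulVec x i / x i * z i ^ 2 - triForm a x z z)
      = ∑ i, ∑ j, hessianMatrix a x i j * x i * x j * (z i / x i - z j / x j) ^ 2 := by
  have hsymm : ∀ i j, hessianMatrix a x i j = hessianMatrix a x j i := fun i j => by
    simp only [hessianMatrix, Matrix.of_apply]
    exact Finset.sum_congr rfl fun k _ => by rw [h23]
  have e1 : ∑ i, (hessianMatrix a x).mulVec x i / x i * z i ^ 2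
      = ∑ i, ∑ j, hessianMatrix a x i j * x j * z i ^ 2 / x i := by
    refine Finset.sum_congr rfl fun i _ => ?_
    rw [Matrix.mulVec, dotProduct, div_mul_eq_mul_div, Finset.sum_mul, Finset.sum_div]
  have e2 : ∑ i, ∑ j, hessianMatrix a x i j * x j * z i ^ 2 / x i
      = ∑ i, ∑ j, hessianMatrix a x i j * x i * z j ^ 2 / x j := by
    rw [Finset.sum_comm]
    exact Finset.sum_congr rfl fun i _ => Finset.sum_congr rfl fun j _ => by rw [hsymm i j]
  have e3 : triForm a x z z = ∑ i, ∑ j, hessianMatrix a x i j * z i * z j := by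
    rw [triForm_eq_dotProduct]
    simp only [dotProduct, Matrix.mulVec, Finset.mul_sum]
    exact Finset.sum_congr rfl fun i _ => Finset.sum_congr rfl fun j _ => by ring
  have e4 : ∀ i j, hessianMatrix a x i j * x i * x j * (z i / x i - z j / x j) ^ 2
      = hessianMatrix a x i j * x j * z i ^ 2 / x i + hessianMatrix a x i j * x i * z j ^ 2 / x j
        - 2 * (hessianMatrix a x i j * z i * z j) := fun i j => by
    have := (hx i).ne'
    have := (hx j).ne'
    field_simp
    ring
  simp only [e4, Finset.sum_add_distrib, Finset.sum_sub_distrib, ← Finset.mul_sum]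
  rw [← e3, ← e2, ← e1]
  ring

theorem hessianMatrix_nonneg (h0 : ∀ i j k, 0 ≤ a i j k) {x : Fin n → ℝ} (hx : ∀ i, 0 < x i)
    (i j : Fin n) : 0 ≤ hessianMatrix a x i j := by
  simp only [hessianMatrix, Matrix.of_apply]
  exact Finset.sum_nonneg fun k _ => mul_nonneg (h0 k i j) (hx k).le

theorem hessianMatrix_mulVec_nonneg (h0 : ∀ i j k, 0 ≤ a i j k) {x : Fin n → ℝ}
    (hx : ∀ i, 0 < x i) (i : Fin n) : 0 ≤ (hessianMatrix a x).mulVec x i := by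
  unfold Matrix.mulVec dotProduct
  exact Finset.sum_nonneg fun j _ => mul_nonneg (hessianMatrix_nonneg h0 hx i j) (hx j).le

/-- The weights `(H x)_i / x_i`, replaced by `1` for the variables that do not occur. -/
noncomputable def degreeWeight (a : Fin n → Fin n → Fin n → ℝ) (x : Fin n → ℝ) (i : Fin n) : ℝ :=
  if (hessianMatrix a x).mulVec x i = 0 then 1 else (hessianMatrix a x).mulVec x i / x i

theorem degreeWeight_pos (h0 : ∀ i j k, 0 ≤ a i j k) {x : Fin n → ℝ} (hx : ∀ i, 0 < x i)
    (i : Fin n) : 0 < degreeWeight a x i := by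
  unfold degreeWeight
  split_ifs with h
  · exact one_pos
  · exact div_pos (lt_of_le_of_ne (hessianMatrix_mulVec_nonneg h0 hx i) (Ne.symm h)) (hx i)

theorem div_le_degreeWeight (i : Fin n) (x : Fin n → ℝ) :
    (hessianMatrix a x).mulVec x i / x i ≤ degreeWeight a x i := by
  unfold degreeWeight
  split_ifs with h
  · simp [h]
  · exact le_rfl

variable (h0 : ∀ i j k, 0 ≤ a i j k) (h12 : ∀ i j k, a i j k = a j i k)
  (h23 : ∀ i j k, a i j k = a i k j)
include h0 h12 h23

/-- `H ≤ H D⁻¹ H` for the Hessian `H` at `x`: sum the reversed Cauchy–Schwarz inequalities of the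
slices, weighted by `x`. -/
theorem triForm_le_sum_mulVec_sq_div
    (hs : ∀ k h, triForm a (Pi.single k 1) h h * triForm a (Pi.single k 1) 1 1
      ≤ triForm a (Pi.single k 1) 1 h ^ 2) {x : Fin n → ℝ} (hx : ∀ i, 0 < x i) (z : Fin n → ℝ) :
    triForm a x z z ≤ ∑ k, (hessianMatrix a x).mulVec z k ^ 2 / degreeWeight a x k := by
  rw [triForm_eq_sum_single]
  refine Finset.sum_le_sum fun k _ => ?_
  have hk0 : ∀ i, 0 ≤ (Pi.single k 1 : Fin n → ℝ) i := fun i => by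
    by_cases h : i = k
    · subst h; simp
    · simp [h]
  have hD := degreeWeight_pos h0 hx k
  by_cases hw : (hessianMatrix a x).mulVec x k = 0
  · have ha := slice_eq_zero_of_triForm_eq_zero h0 (k := k) hx hx
      (by rw [triForm_single_eq_mulVec h12, hw])
    have : triForm a (Pi.single k 1) z z = 0 := by
      rw [triForm_single_left]
      simp [ha]
    rw [this, mul_zero]
    positivity
  · have hw' := lt_of_le_of_ne (hessianMatrix_mulVec_nonneg h0 hx k) (Ne.symm hw)
    have h1 : 0 < triForm a (Pi.single k 1) 1 1 := by
      refine lt_of_le_of_ne (triForm_nonneg h0 hk0 (fun _ => zero_le_one) fun _ => zero_le_one)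
        fun h1 => hw ?_
      have ha := slice_eq_zero_of_triForm_eq_zero h0 (k := k) (fun _ => one_pos)
        (fun _ => one_pos) h1.symm
      rw [← triForm_single_eq_mulVec h12, triForm_single_left]
      simp [ha]
    have h2 := reverse_cauchySchwarz_of_pos h23 h1 (hs k)
      (triForm_nonneg h0 hk0 (fun i => (hx i).le) fun i => (hx i).le) z
    rw [triForm_single_eq_mulVec h12 k x x, triForm_single_eq_mulVec h12 k x z] at h2
    rw [degreeWeight, if_neg hw, div_div_eq_mul_div, le_div_iff₀ hw']
    nlinarith [mul_le_mul_of_nonneg_left h2 (hx k).le]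

omit h12 in
/-- `H ≤ D` for the Hessian `H` at `x`. -/
theorem triForm_le_sum_degreeWeight {x : Fin n → ℝ} (hx : ∀ i, 0 < x i) (z : Fin n → ℝ) :
    triForm a x z z ≤ ∑ i, degreeWeight a x i * z i ^ 2 := by
  have h1 := sum_div_mul_sq_sub_eq_laplacian h23 hx z
  have h2 : 0 ≤ ∑ i, ∑ j, hessianMatrix a x i j * x i * x j * (z i / x i - z j / x j) ^ 2 :=
    Finset.sum_nonneg fun i _ => Finset.sum_nonneg fun j _ =>
      mul_nonneg (mul_nonneg (mul_nonneg (hessianMatrix_nonneg h0 hx i j) (hx i).le) (hx j).le)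
        (sq_nonneg _)
  have h3 : ∑ i, (hessianMatrix a x).mulVec x i / x i * z i ^ 2
      ≤ ∑ i, degreeWeight a x i * z i ^ 2 :=
    Finset.sum_le_sum fun i _ => mul_le_mul_of_nonneg_right (div_le_degreeWeight i x) (sq_nonneg _)
  linarith

/-- In the equality case of `H ≤ D`, the vector is proportional to `x` on the occurring variables.
The Laplacian vanishes at `z`, so that `u_i = z_i / x_i` is constant along the edges of the graph of
pairs of variables with a common monomial; the reversed Cauchy–Schwarz inequality at `(1, …, 1)`,
tested on `u`, forbids more than one component. -/
theorem proportional_of_triForm_eq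
    (hone : ∀ h, triForm a 1 h h * triForm a 1 1 1 ≤ triForm a 1 1 h ^ 2) {x : Fin n → ℝ}
    (hx : ∀ i, 0 < x i) {z : Fin n → ℝ}
    (hz : triForm a x z z = ∑ i, degreeWeight a x i * z i ^ 2) :
    (∀ i, (hessianMatrix a x).mulVec x i = 0 → z i = 0) ∧
      ∀ i j, (hessianMatrix a x).mulVec x i ≠ 0 → (hessianMatrix a x).mulVec x j ≠ 0 →
        z i / x i = z j / x j := by
  set H := hessianMatrix a x with hH
  have hHn := hessianMatrix_nonneg h0 hx
  have h1 := sum_div_mul_sq_sub_eq_laplacian h23 hx z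
  have nn : ∀ i j, 0 ≤ H i j * x i * x j * (z i / x i - z j / x j) ^ 2 := fun i j =>
      mul_nonneg (mul_nonneg (mul_nonneg (hHn i j) (hx i).le) (hx j).le)
        (sq_nonneg _)
  have h2 : 0 ≤ ∑ i, ∑ j, H i j * x i * x j * (z i / x i - z j / x j) ^ 2 :=
    Finset.sum_nonneg fun i _ => Finset.sum_nonneg fun j _ => nn i j
  have h3 : ∀ i ∈ Finset.univ, H.mulVec x i / x i * z i ^ 2 ≤ degreeWeight a x i * z i ^ 2 :=
    fun i _ => mul_le_mul_of_nonneg_right (div_le_degreeWeight i x) (sq_nonneg _)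
  have h4 := Finset.sum_le_sum h3
  have h5 := (Finset.sum_eq_sum_iff_of_le h3).1 (by linarith)
  have h6 : ∑ i, ∑ j, H i j * x i * x j * (z i / x i - z j / x j) ^ 2 = 0 := by linarith
  have h7 : ∀ i j, H i j ≠ 0 → z i / x i = z j / x j := by
    intro i j hij
    have h8 := (Finset.sum_eq_zero_iff_of_nonneg fun i _ => Finset.sum_nonneg fun j _ => nn i j).1
      h6 i (Finset.mem_univ i)
    have h9 := (Finset.sum_eq_zero_iff_of_nonneg fun j _ => nn i j).1 h8 j (Finset.mem_univ j)
    have := (mul_eq_zero.1 h9).resolve_left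
      (mul_ne_zero (mul_ne_zero hij (hx i).ne') (hx j).ne')
    exact sub_eq_zero.1 (pow_eq_zero_iff two_ne_zero |>.1 this)
  refine ⟨fun i hi => ?_, fun i j hi hj => ?_⟩
  · have := h5 i (Finset.mem_univ i)
    rw [hi, degreeWeight, if_pos hi] at this
    simpa using this.symm
  set u : Fin n → ℝ := fun i => z i / x i
  set G := hessianMatrix a 1
  have hGu : ∀ i j, G i j * u j = G i j * u i := by
    intro i j
    by_cases hG : G i j = 0
    · simp [hG]
    have : H i j ≠ 0 := fun hHij => hG <| by
      simp only [hH, G, hessianMatrix, Matrix.of_apply] at hHij ⊢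
      have h8 := (Finset.sum_eq_zero_iff_of_nonneg fun k _ =>
        mul_nonneg (h0 k i j) (hx k).le).1 hHij
      refine Finset.sum_eq_zero fun k hk => ?_
      have := h8 k hk
      rw [mul_eq_zero, or_iff_left (hx k).ne'] at this
      simp [this]
    rw [show u j = u i from (h7 i j this).symm]
  have e : G.mulVec u = fun i => G.mulVec 1 i * u i := by
    funext i
    simp only [Matrix.mulVec, dotProduct, hGu, Finset.sum_mul, Pi.one_apply, mul_one]
  have hpos : ∀ i, H.mulVec x i ≠ 0 → 0 < G.mulVec 1 i := by
    intro i hi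
    refine lt_of_le_of_ne (hessianMatrix_mulVec_nonneg h0 (fun _ => one_pos) i) fun hi0 => hi ?_
    have ha := slice_eq_zero_of_triForm_eq_zero h0 (k := i) (x := 1) (y := 1) (fun _ => one_pos)
      (fun _ => one_pos) (by rw [triForm_single_eq_mulVec h12]; exact hi0.symm)
    rw [hH, ← triForm_single_eq_mulVec h12, triForm_single_left]
    simp [ha]
  refine eq_of_sum_mul_sq_le (r := G.mulVec 1) (u := u)
    (fun i => hessianMatrix_mulVec_nonneg h0 (fun _ => one_pos) i) ?_ (hpos i hi) (hpos j hj)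
  have := hone u
  rw [triForm_eq_dotProduct, triForm_eq_dotProduct 1 1, triForm_eq_dotProduct 1 1] at this
  change dotProduct u (G.mulVec u) * dotProduct 1 (G.mulVec 1) ≤ dotProduct 1 (G.mulVec u) ^ 2
    at this
  rw [e, one_dotProduct, one_dotProduct] at this
  refine le_trans (le_of_eq ?_) this
  congr 1
  exact Finset.sum_congr rfl fun i _ => by ring

/-- The Hessian at a positive point has at most one positive eigenvalue. With `D` the diagonal
matrix of the weights, the eigenvalues `l` of `D^{-1/2} H D^{-1/2}` satisfy `l ≤ l²` and `l ≤ 1`, so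
that a positive one is equal to `1`, and then its eigenvector is the one that comes from `x`. -/
theorem hessian_of_slices
    (hs : ∀ k h, triForm a (Pi.single k 1) h h * triForm a (Pi.single k 1) 1 1
      ≤ triForm a (Pi.single k 1) 1 h ^ 2)
    (hone : ∀ h, triForm a 1 h h * triForm a 1 1 1 ≤ triForm a 1 1 h ^ 2) {x : Fin n → ℝ}
    (hx : ∀ i, 0 < x i) {z : Fin n → ℝ} (hz : triForm a x x z = 0) : triForm a x z z ≤ 0 := by
  set H := hessianMatrix a x with hH
  set D := degreeWeight a x with hDdef
  have hD := degreeWeight_pos h0 hx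
  set s : Fin n → ℝ := fun i => √(D i)
  have hs0 : ∀ i, 0 < s i := fun i => Real.sqrt_pos.2 (hD i)
  have hs2 : ∀ i, s i * s i = D i := fun i => Real.mul_self_sqrt (hD i).le
  have hsymm : ∀ i j, H i j = H j i := fun i j => by
    simp only [hH, hessianMatrix, Matrix.of_apply]
    exact Finset.sum_congr rfl fun k _ => by rw [h23]
  set B : Matrix (Fin n) (Fin n) ℝ := Matrix.of fun i j => H i j / (s i * s j) with hBdef
  have hB : B.IsHermitian := by
    ext i j
    simp only [hBdef, Matrix.conjTranspose_apply, Matrix.of_apply, star_trivial]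
    rw [hsymm, mul_comm]
  have hBv : ∀ (y : Fin n → ℝ) i, B.mulVec (fun i => s i * y i) i = H.mulVec y i / s i := by
    intro y i
    simp only [Matrix.mulVec, dotProduct, hBdef, Matrix.of_apply, Finset.sum_div]
    refine Finset.sum_congr rfl fun j _ => ?_
    have := (hs0 i).ne'
    have := (hs0 j).ne'
    field_simp
  have hquad : triForm a x z z
      = dotProduct (fun i => s i * z i) (B.mulVec fun i => s i * z i) := by
    rw [triForm_eq_dotProduct]
    refine Finset.sum_congr rfl fun i _ => ?_
    rw [hBv]
    have := (hs0 i).ne'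
    field_simp
    rfl
  rw [hquad]
  refine dotProduct_mulVec_nonpos_of_eigenvectors hB fun b l hb hl => ?_
  set y : Fin n → ℝ := fun i => b i / s i
  have hby : b = fun i => s i * y i := by
    funext i
    simp only [y]
    rw [mul_div_cancel₀ _ (hs0 i).ne']
  have hHy : ∀ i, H.mulVec y i = l * (D i * y i) := by
    intro i
    have h1 := congrFun hl i
    rw [hby, hBv, div_eq_iff (hs0 i).ne', Pi.smul_apply, smul_eq_mul] at h1
    rw [h1, ← hs2 i]
    ring
  set N := ∑ i, D i * y i ^ 2 with hN
  have hNpos : 0 < N := by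
    obtain ⟨i, hi⟩ := Function.ne_iff.1 hb
    refine Finset.sum_pos' (fun i _ => mul_nonneg (hD i).le (sq_nonneg _))
      ⟨i, Finset.mem_univ i, mul_pos (hD i) ?_⟩
    have : y i ≠ 0 := div_ne_zero hi (hs0 i).ne'
    positivity
  have hyy : triForm a x y y = l * N := by
    rw [triForm_eq_dotProduct, hN, Finset.mul_sum]
    exact Finset.sum_congr rfl fun i _ => by rw [hHy]; ring
  have hA : l * N ≤ l ^ 2 * N := by
    rw [← hyy]
    refine (triForm_le_sum_mulVec_sq_div h0 h12 h23 hs hx y).trans (le_of_eq ?_)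
    rw [hN, Finset.mul_sum]
    refine Finset.sum_congr rfl fun i _ => ?_
    rw [hHy, ← hDdef]
    have := (hD i).ne'
    field_simp
  have hle : l * N ≤ 1 * N := by
    rw [← hyy, one_mul]
    exact triForm_le_sum_degreeWeight h0 h23 hx y
  have hl1 := le_of_mul_le_mul_right hle hNpos
  have hl2 := le_of_mul_le_mul_right hA hNpos
  rcases le_or_gt l 0 with hl0 | hl0
  · exact Or.inl hl0
  obtain rfl : l = 1 := le_antisymm hl1 (by nlinarith)
  right
  obtain ⟨hy0, hyc⟩ := proportional_of_triForm_eq h0 h12 h23 hone hx (z := y)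
    (by rw [hyy, one_mul])
  have hbz : dotProduct b (fun i => s i * z i) = ∑ i, D i * y i * z i := by
    rw [hby]
    refine Finset.sum_congr rfl fun i _ => ?_
    rw [← hs2 i]
    ring
  rw [hbz]
  by_cases hact : ∃ i, H.mulVec x i ≠ 0
  · obtain ⟨i₀, hi₀⟩ := hact
    have : ∑ i, D i * y i * z i = y i₀ / x i₀ * ∑ i, H.mulVec x i * z i := by
      rw [Finset.mul_sum]
      refine Finset.sum_congr rfl fun i _ => ?_
      by_cases hi : H.mulVec x i = 0
      · rw [hi, hy0 i hi]
        ring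
      · rw [← hyc i i₀ hi hi₀, hDdef, degreeWeight, if_neg hi]
        ring
    rw [this]
    have hxz : ∑ i, H.mulVec x i * z i = triForm a x z x := by
      rw [triForm_eq_dotProduct]
      exact Finset.sum_congr rfl fun i _ => mul_comm _ _
    rw [hxz, triForm_swap_right h23, hz, mul_zero]
  · push Not at hact
    exact Finset.sum_eq_zero fun i _ => by rw [hy0 i (hact i)]; ring

/-- Reversed Cauchy–Schwarz at all positive points is equivalent to reversed Cauchy–Schwarz against
`(1, …, 1)` for the slices and for their sum. -/
theorem hessian_iff_slices :
    (∀ x : Fin n → ℝ, (∀ i, 0 < x i) → ∀ h,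
        triForm a x h h * triForm a x x x ≤ triForm a x x h ^ 2) ↔
      (∀ k h, triForm a (Pi.single k 1) h h * triForm a (Pi.single k 1) 1 1
        ≤ triForm a (Pi.single k 1) 1 h ^ 2) ∧
      ∀ h, triForm a 1 h h * triForm a 1 1 1 ≤ triForm a 1 1 h ^ 2 := by
  constructor
  · intro H
    refine ⟨fun k h => ?_, fun h => H 1 (fun _ => one_pos) h⟩
    have key : ∀ x : Fin n → ℝ, (∀ i, 0 < x i) →
        triForm a x h h * triForm a x 1 1 ≤ triForm a x 1 h ^ 2 := by
      intro x hx
      rcases (triForm_nonneg h0 (fun i => (hx i).le) (fun i => (hx i).le)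
        (fun i => (hx i).le)).eq_or_lt with h1 | h1
      · have ha : ∀ i j k, a i j k = 0 := by
          intro i
          rw [triForm_eq_sum_single] at h1
          have hnn : ∀ i, 0 ≤ triForm a (Pi.single i 1) x x := fun i => by
            rw [triForm_single_eq_mulVec h12]
            exact hessianMatrix_mulVec_nonneg h0 hx i
          have h2 := (Finset.sum_eq_zero_iff_of_nonneg fun i _ =>
            mul_nonneg (hx i).le (hnn i)).1 h1.symm i (Finset.mem_univ i)
          exact slice_eq_zero_of_triForm_eq_zero h0 hx hx
            ((mul_eq_zero.1 h2).resolve_left (hx i).ne')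
        simp [triForm, ha]
      · exact reverse_cauchySchwarz_of_pos h23 h1 (H x hx)
          (triForm_nonneg h0 (fun i => (hx i).le) (fun _ => zero_le_one) fun _ => zero_le_one) h
    -- the slice at `k` is the limit of the Hessians at `e_k + ε (1, …, 1)`
    have hx : Continuous fun e : ℝ => (Pi.single k 1 + e • 1 : Fin n → ℝ) := by fun_prop
    have hlim : ∀ u v : Fin n → ℝ, Filter.Tendsto
        (fun e : ℝ => triForm a (Pi.single k 1 + e • 1) u v) (nhdsWithin 0 (Set.Ioi 0))
        (nhds (triForm a (Pi.single k 1) u v)) := by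
      intro u v
      have := ((continuous_triForm (a := a) hx (continuous_const (y := u))
        (continuous_const (y := v))).tendsto 0).mono_left
          (nhdsWithin_le_nhds (s := Set.Ioi 0))
      simpa using this
    refine le_of_tendsto_of_tendsto ((hlim h h).mul (hlim 1 1)) ((hlim 1 h).pow 2) ?_
    filter_upwards [self_mem_nhdsWithin] with e he
    refine key _ fun i => ?_
    have he : 0 < e := he
    have : 0 ≤ (Pi.single k 1 : Fin n → ℝ) i := by
      by_cases h : i = k
      · subst h; simp
      · simp [h]
    simp only [Pi.add_apply, Pi.smul_apply, Pi.one_apply, smul_eq_mul, mul_one]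
    linarith
  · rintro ⟨hs, hone⟩ x hx h
    rcases (triForm_nonneg h0 (fun i => (hx i).le) (fun i => (hx i).le)
      (fun i => (hx i).le)).eq_or_lt with h1 | h1
    · rw [← h1, mul_zero]
      positivity
    -- subtract from `h` its component along `x`
    set u := triForm a x x h / triForm a x x x
    have hu : u * triForm a x x x = triForm a x x h := div_mul_cancel₀ _ h1.ne'
    have h2 := hessian_of_slices h0 h12 h23 hs hone hx (z := h + (-u) • x)
      (by rw [triForm_add_right, triForm_smul_right]; linarith)
    rw [triForm_line_right h23, triForm_swap_right h23 x h x] at h2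
    have h3 : triForm a x h h ≤ u * triForm a x x h := by
      rw [← hu] at h2 ⊢
      linarith
    calc triForm a x h h * triForm a x x x ≤ u * triForm a x x h * triForm a x x x :=
          mul_le_mul_of_nonneg_right h3 h1.le
      _ = triForm a x x h ^ 2 := by rw [mul_right_comm, hu]; ring

end Sufficiency

/-! ### Symmetric elimination and positive semidefiniteness -/

/-- Gaussian elimination without pivoting on a matrix indexed by the natural numbers: after `p`
steps, with the pivots at `(0, 0), …, (p - 1, p - 1)`. A step with a zero pivot changes nothing,
since a division by zero returns zero. -/
def eliminate {K : Type*} [Field K] (M : ℕ → ℕ → K) : ℕ → ℕ → ℕ → K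
  | 0, i, j => M i j
  | p + 1, i, j => eliminate M p i j - eliminate M p i p * eliminate M p p j / eliminate M p p p

/-- The outcome of the elimination that characterizes positive semidefinite matrices: the pivots are
nonnegative and nothing is left in the end. -/
def EliminationPasses {K : Type*} [Field K] [LinearOrder K] (n : ℕ) (M : ℕ → ℕ → K) : Prop :=
  (∀ p < n, 0 ≤ eliminate M p p p) ∧ ∀ i < n, ∀ j < n, eliminate M n i j = 0

theorem eliminate_symm {K : Type*} [Field K] {M : ℕ → ℕ → K} (hM : ∀ i j, M i j = M j i) (p : ℕ) :
    ∀ i j, eliminate M p i j = eliminate M p j i := by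
  induction p with
  | zero => exact hM
  | succ p ih =>
    intro i j
    rw [eliminate, eliminate, ih i j, ih i p, ih p j]
    ring

theorem map_eliminate {K L : Type*} [Field K] [Field L] (φ : K →+* L) (M : ℕ → ℕ → K)
    (p : ℕ) : ∀ i j, eliminate (fun i j => φ (M i j)) p i j = φ (eliminate M p i j) := by
  induction p with
  | zero => exact fun _ _ => rfl
  | succ p ih =>
    intro i j
    rw [eliminate, eliminate, ih, ih, ih, ih, map_sub, map_div₀, map_mul]

/-- The value at `x` of the quadratic form given by the leading `n × n` block of `M`. -/
def quadForm {n : ℕ} (M : ℕ → ℕ → ℝ) (x : Fin n → ℝ) : ℝ :=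
  ∑ i : Fin n, ∑ j : Fin n, M i j * x i * x j

section QuadForm

variable {n : ℕ} {M : ℕ → ℕ → ℝ}

theorem quadForm_add_smul_single (hM : ∀ i j, M i j = M j i) (x : Fin n → ℝ) (t : ℝ) (p : Fin n) :
    quadForm M (x + t • Pi.single p 1)
      = quadForm M x + 2 * t * (∑ i : Fin n, M i p * x i) + t ^ 2 * M p p := by
  have e1 : ∑ i : Fin n, ∑ j : Fin n, M i j * x i * (t * (Pi.single p 1 : Fin n → ℝ) j)
      = t * ∑ i : Fin n, M i p * x i := by
    rw [Finset.mul_sum]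
    refine Finset.sum_congr rfl fun i _ => ?_
    rw [Finset.sum_eq_single p (fun j _ hj => by simp [hj]) (by simp)]
    simp
    ring
  have e2 : ∑ i : Fin n, ∑ j : Fin n, M i j * (t * (Pi.single p 1 : Fin n → ℝ) i) * x j
      = t * ∑ i : Fin n, M i p * x i := by
    rw [← e1, Finset.sum_comm]
    refine Finset.sum_congr rfl fun i _ => Finset.sum_congr rfl fun j _ => ?_
    rw [hM]
    ring
  have e3 : ∑ i : Fin n, ∑ j : Fin n, M i j * (t * (Pi.single p 1 : Fin n → ℝ) i) *
      (t * (Pi.single p 1 : Fin n → ℝ) j) = t ^ 2 * M p p := by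
    rw [Finset.sum_eq_single p (fun i _ hi => by simp [hi]) (by simp),
      Finset.sum_eq_single p (fun i _ hi => by simp [hi]) (by simp)]
    simp
    ring
  have e : quadForm M (x + t • Pi.single p 1)
      = quadForm M x
        + ∑ i : Fin n, ∑ j : Fin n, M i j * x i * (t * (Pi.single p 1 : Fin n → ℝ) j)
        + ∑ i : Fin n, ∑ j : Fin n, M i j * (t * (Pi.single p 1 : Fin n → ℝ) i) * x j
        + ∑ i : Fin n, ∑ j : Fin n, M i j * (t * (Pi.single p 1 : Fin n → ℝ) i) *
          (t * (Pi.single p 1 : Fin n → ℝ) j) := by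
    simp only [quadForm, ← Finset.sum_add_distrib, Pi.add_apply, Pi.smul_apply, smul_eq_mul]
    refine Finset.sum_congr rfl fun i _ => Finset.sum_congr rfl fun j _ => by ring
  rw [e, e1, e2, e3]
  ring

theorem quadForm_eliminate_succ (hM : ∀ i j, M i j = M j i) (p : ℕ) (x : Fin n → ℝ) :
    quadForm (eliminate M (p + 1)) x = quadForm (eliminate M p) x
      - (∑ i : Fin n, eliminate M p i p * x i) ^ 2 / eliminate M p p p := by
  have h : (∑ i : Fin n, eliminate M p i p * x i) ^ 2 / eliminate M p p p
      = ∑ i : Fin n, ∑ j : Fin n,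
        eliminate M p i p * eliminate M p p j / eliminate M p p p * x i * x j := by
    rw [sq, Finset.sum_mul_sum, Finset.sum_div]
    refine Finset.sum_congr rfl fun i _ => ?_
    rw [Finset.sum_div]
    refine Finset.sum_congr rfl fun j _ => ?_
    rw [eliminate_symm hM p p j]
    ring
  rw [h]
  simp only [quadForm, ← Finset.sum_sub_distrib, eliminate]
  refine Finset.sum_congr rfl fun i _ => Finset.sum_congr rfl fun j _ => by ring

theorem quadForm_single (p : Fin n) : quadForm M (Pi.single p 1) = M p p := by
  unfold quadForm
  rw [Finset.sum_eq_single p (fun i _ hi => by simp [hi]) (by simp),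
    Finset.sum_eq_single p (fun i _ hi => by simp [hi]) (by simp)]
  simp

/-- A zero on the diagonal of a positive semidefinite matrix comes with a zero column. -/
theorem apply_eq_zero_of_quadForm_nonneg (hM : ∀ i j, M i j = M j i)
    (hq : ∀ x : Fin n → ℝ, 0 ≤ quadForm M x) {p : Fin n} (hp : M p p = 0) (i : Fin n) :
    M i p = 0 := by
  by_contra hne
  -- the form is affine on the line `e_i + t e_p`, and equal to `-1` for this value of `t`
  have h := hq (Pi.single i 1 + (-(M i i + 1) / (2 * M i p)) • Pi.single p 1)
  rw [quadForm_add_smul_single hM, quadForm_single, hp,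
    Finset.sum_eq_single i (fun j _ hj => by simp [hj]) (by simp)] at h
  simp only [Pi.single_eq_same, mul_one, mul_zero, add_zero] at h
  have : 2 * (-(M i i + 1) / (2 * M i p)) * M i p = -(M i i + 1) := by
    field_simp
  linarith

theorem quadForm_nonneg_iff_eliminationPasses (hM : ∀ i j, M i j = M j i) :
    (∀ x : Fin n → ℝ, 0 ≤ quadForm M x) ↔ EliminationPasses n M := by
  constructor
  · intro hq
    have key : ∀ p ≤ n, (∀ x : Fin n → ℝ, 0 ≤ quadForm (eliminate M p) x) ∧
        ∀ i < n, ∀ s < p, eliminate M p i s = 0 := by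
      intro p
      induction p with
      | zero => exact fun _ => ⟨hq, fun _ _ s hs => absurd hs (Nat.not_lt_zero s)⟩
      | succ p ih =>
        intro hp
        obtain ⟨h1, h2⟩ := ih (by omega)
        have hs := eliminate_symm hM p
        have hd := h1 (Pi.single ⟨p, hp⟩ 1)
        rw [quadForm_single] at hd
        refine ⟨fun x => ?_, fun i hi s hsp => ?_⟩
        · rw [quadForm_eliminate_succ hM]
          rcases hd.eq_or_lt with h | h
          · simp only at h
            rw [← h, div_zero, sub_zero]
            exact h1 x
          · simp only at h
            -- minimize the form over the line `x + t e_p`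
            have h3 := h1 (x + (-(∑ i : Fin n, eliminate M p i p * x i) / eliminate M p p p) •
              Pi.single ⟨p, hp⟩ 1)
            rw [quadForm_add_smul_single hs] at h3
            refine h3.trans (le_of_eq ?_)
            field_simp
            ring
        · rw [eliminate]
          rcases Nat.lt_succ_iff_lt_or_eq.1 hsp with h | rfl
          · rw [h2 i hi s h, h2 p hp s h]
            simp
          · by_cases h : eliminate M s s s = 0
            · rw [apply_eq_zero_of_quadForm_nonneg hs h1 (p := ⟨s, hp⟩) h ⟨i, hi⟩]
              simp
            · field_simp
              ring
    refine ⟨fun p hp => ?_, fun i hi j hj => (key n le_rfl).2 i hi j hj⟩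
    have := (key p hp.le).1 (Pi.single ⟨p, hp⟩ 1)
    rwa [quadForm_single] at this
  · rintro ⟨hd, h0⟩ x
    have key : ∀ m ≤ n, quadForm (eliminate M m) x ≤ quadForm M x := by
      intro m
      induction m with
      | zero => exact fun _ => le_rfl
      | succ m ih =>
        intro hm
        refine le_trans ?_ (ih (by omega))
        rw [quadForm_eliminate_succ hM]
        exact sub_le_self _ (div_nonneg (sq_nonneg _) (hd m hm))
    have h1 := key n le_rfl
    have h2 : quadForm (eliminate M n) x = 0 :=
      Finset.sum_eq_zero fun i _ => Finset.sum_eq_zero fun j _ => by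
        rw [h0 i i.2 j j.2]
        ring
    rwa [h2] at h1

end QuadForm

/-! ### The criterion in terms of the input array -/

section Criterion

variable {K : Type*} [Field K]

/-- The coefficient of `x_k x_i x_j`, doubled if `i = j`. -/
def doubledEntry (c : ℕ → ℕ → ℕ → K) (k i j : ℕ) : K :=
  if i = j then c k i j + c k i j else c k i j

/-- The third partial derivative `∂_k ∂_i ∂_j f` in terms of the array `c` of the coefficients. -/
def partialEntry (c : ℕ → ℕ → ℕ → K) (k i j : ℕ) : K :=
  doubledEntry c k i j + (if k = i then doubledEntry c k i j else 0)
    + if k = j then doubledEntry c k i j else 0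

/-- The matrices to be tested: the Hessians of the `∂_k f` for `k < n`, and for `k = n` the Hessian
of `f` at `(1, …, 1)`, which is their sum. -/
def testMatrix (c : ℕ → ℕ → ℕ → K) (n k i j : ℕ) : K :=
  if k < n then partialEntry c k i j else ∑ l ∈ Finset.range n, partialEntry c l i j

/-- The sum of the entries of row `i` of the leading `n × n` block, the entry at `i` of `A 1`. -/
def rowSum (n : ℕ) (A : ℕ → ℕ → K) (i : ℕ) : K := ∑ j ∈ Finset.range n, A i j

/-- The sum of all entries of the leading `n × n` block, `1ᵀ A 1`. -/
def totalSum (n : ℕ) (A : ℕ → ℕ → K) : K := ∑ i ∈ Finset.range n, rowSum n A i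

/-- The matrix `(A 1)(A 1)ᵀ - (1ᵀ A 1) A`. It is positive semidefinite iff the reversed
Cauchy–Schwarz inequality against `(1, …, 1)` holds for `A`. -/
def defect (n : ℕ) (A : ℕ → ℕ → K) (i j : ℕ) : K :=
  rowSum n A i * rowSum n A j - totalSum n A * A i j

/-- The criterion that the program evaluates. -/
def Accepts [LinearOrder K] (n : ℕ) (c : ℕ → ℕ → ℕ → K) : Prop :=
  ∀ k ≤ n, EliminationPasses n (defect n (testMatrix c n k))

end Criterion

theorem quadForm_defect {n : ℕ} (A : ℕ → ℕ → ℝ) (x : Fin n → ℝ) :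
    quadForm (defect n A) x
      = (∑ i : Fin n, rowSum n A i * x i) ^ 2 - totalSum n A * quadForm A x := by
  rw [sq, Finset.sum_mul_sum, quadForm, quadForm, Finset.mul_sum, ← Finset.sum_sub_distrib]
  refine Finset.sum_congr rfl fun i _ => ?_
  rw [Finset.mul_sum, ← Finset.sum_sub_distrib]
  refine Finset.sum_congr rfl fun j _ => ?_
  rw [defect]
  ring

section Input

open ArithRAM

variable {K : Type} [Field K] {n : ℕ}

/-- The array that holds the coefficients of `f` in the input. -/
noncomputable def inputArray (f : MvPolynomial (Fin n) K) : ℕ → ℕ → ℕ → K :=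
  (cubicInput f).num 0

theorem inputArray_coe (f : MvPolynomial (Fin n) K) (i j k : Fin n) :
    inputArray f i j k
      = f.coeff (Finsupp.single i 1 + Finsupp.single j 1 + Finsupp.single k 1) := by
  simp [inputArray, cubicInput]

theorem inputArray_swap_right (f : MvPolynomial (Fin n) K) (i j k : ℕ) :
    inputArray f i j k = inputArray f i k j := by
  by_cases h : i < n ∧ j < n ∧ k < n
  · obtain ⟨hi, hj, hk⟩ := h
    have h1 := inputArray_coe f ⟨i, hi⟩ ⟨j, hj⟩ ⟨k, hk⟩
    have h2 := inputArray_coe f ⟨i, hi⟩ ⟨k, hk⟩ ⟨j, hj⟩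
    rw [add_right_comm] at h2
    exact h1.trans h2.symm
  · simp only [inputArray, cubicInput, true_and]
    rw [dif_neg h, dif_neg (by tauto)]

theorem partialEntry_swap {c : ℕ → ℕ → ℕ → K} (hc : ∀ i j k, c i j k = c i k j) (k i j : ℕ) :
    partialEntry c k i j = partialEntry c k j i := by
  unfold partialEntry doubledEntry
  rw [hc k j i]
  by_cases h : i = j
  · subst h
    rfl
  · rw [if_neg h, if_neg (Ne.symm h)]
    ring

theorem partialEntry_inputArray (f : MvPolynomial (Fin n) K) (k i j : Fin n) :
    partialEntry (inputArray f) k i j = thirdPartial f k i j := by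
  unfold partialEntry doubledEntry thirdPartial
  rw [inputArray_coe]
  simp only [Fin.val_inj]
  split_ifs <;> first | (exfalso; simp_all; done) | ring

theorem testMatrix_swap {c : ℕ → ℕ → ℕ → K} (hc : ∀ i j k, c i j k = c i k j) (k i j : ℕ) :
    testMatrix c n k i j = testMatrix c n k j i := by
  simp only [testMatrix, partialEntry_swap hc _ i j]

theorem defect_swap {A : ℕ → ℕ → K} (hA : ∀ i j, A i j = A j i) (i j : ℕ) :
    defect n A i j = defect n A j i := by
  rw [defect, defect, hA i j, mul_comm (rowSum n A i)]

theorem isLogConcave_iff_accepts {f : MvPolynomial (Fin n) ℝ} (hf : f.IsHomogeneous 3)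
    (hc : ∀ m, 0 ≤ f.coeff m) : IsLogConcave f ↔ Accepts n (inputArray f) := by
  have key : ∀ (A : ℕ → ℕ → ℝ), (∀ i j, A i j = A j i) → (EliminationPasses n (defect n A) ↔
      ∀ h : Fin n → ℝ, quadForm A h * totalSum n A ≤ (∑ i : Fin n, rowSum n A i * h i) ^ 2) := by
    intro A hA
    rw [← quadForm_nonneg_iff_eliminationPasses (defect_swap hA)]
    refine forall_congr' fun h => ?_
    rw [quadForm_defect, sub_nonneg, mul_comm]
  have e : ∀ (x : Fin n → ℝ) (A : ℕ → ℕ → ℝ),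
      (∀ i j : Fin n, A i j = hessianMatrix (thirdPartial f) x i j) →
      (∀ h, quadForm A h = triForm (thirdPartial f) x h h) ∧
        totalSum n A = triForm (thirdPartial f) x 1 1 ∧
        ∀ h : Fin n → ℝ, ∑ i : Fin n, rowSum n A i * h i = triForm (thirdPartial f) x 1 h := by
    intro x A hA
    refine ⟨fun h => ?_, ?_, fun h => ?_⟩
    · rw [triForm_eq_dotProduct]
      simp only [quadForm, hA, dotProduct, Matrix.mulVec, Finset.mul_sum]
      exact Finset.sum_congr rfl fun i _ => Finset.sum_congr rfl fun j _ => by ring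
    · rw [triForm_eq_dotProduct]
      simp [totalSum, rowSum, Finset.sum_range, hA, dotProduct, Matrix.mulVec]
    · rw [triForm_swap_right (thirdPartial_swap_right f), triForm_eq_dotProduct]
      simp only [rowSum, Finset.sum_range, hA, dotProduct, Matrix.mulVec, Pi.one_apply, mul_one]
      exact Finset.sum_congr rfl fun i _ => mul_comm _ _
  have e1 : ∀ k i j : Fin n, testMatrix (inputArray f) n k i j
      = hessianMatrix (thirdPartial f) (Pi.single k 1) i j := by
    intro k i j
    rw [testMatrix, if_pos k.2, partialEntry_inputArray, hessianMatrix, Matrix.of_apply,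
      Finset.sum_eq_single k (fun l _ hl => by simp [hl]) (by simp)]
    simp
  have e2 : ∀ i j : Fin n, testMatrix (inputArray f) n n i j
      = hessianMatrix (thirdPartial f) 1 i j := by
    intro i j
    rw [testMatrix, if_neg (lt_irrefl n), Finset.sum_range]
    simp [partialEntry_inputArray, hessianMatrix]
  have hsw := fun k => testMatrix_swap (n := n) (inputArray_swap_right f) k
  rw [isLogConcave_iff_hessian hf hc, hessian_iff_slices (thirdPartial_nonneg hc)
    (thirdPartial_swap_left f) (thirdPartial_swap_right f)]
  constructor
  · rintro ⟨h1, h2⟩ k hk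
    rw [key _ (hsw k)]
    intro h
    rcases hk.lt_or_eq with hk | rfl
    · obtain ⟨q1, q2, q3⟩ := e _ _ (e1 ⟨k, hk⟩)
      simp only at q1 q2 q3
      rw [q1, q2, q3]
      exact h1 _ h
    · obtain ⟨q1, q2, q3⟩ := e _ _ e2
      rw [q1, q2, q3]
      exact h2 h
  · intro H
    refine ⟨fun k h => ?_, fun h => ?_⟩
    · obtain ⟨q1, q2, q3⟩ := e _ _ (e1 k)
      rw [← q1, ← q2, ← q3]
      exact (key _ (hsw k)).1 (H k k.2.le) h
    · obtain ⟨q1, q2, q3⟩ := e _ _ e2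
      rw [← q1, ← q2, ← q3]
      exact (key _ (hsw n)).1 (H n le_rfl) h

/-- The criterion does not depend on the field over which it is evaluated. -/
theorem accepts_map_iff (f : MvPolynomial (Fin n) ℚ) :
    Accepts n (inputArray (MvPolynomial.map (algebraMap ℚ ℝ) f)) ↔ Accepts n (inputArray f) := by
  have h1 : ∀ i j k, inputArray (MvPolynomial.map (algebraMap ℚ ℝ) f) i j k
      = algebraMap ℚ ℝ (inputArray f i j k) := by
    intro i j k
    simp only [inputArray, cubicInput]
    split_ifs
    · rw [MvPolynomial.coeff_map]
    · rw [map_zero]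
  have h2 : ∀ k i j, partialEntry (inputArray (MvPolynomial.map (algebraMap ℚ ℝ) f)) k i j
      = algebraMap ℚ ℝ (partialEntry (inputArray f) k i j) := by
    intro k i j
    simp only [partialEntry, doubledEntry, h1]
    split_ifs <;> simp
  have h3 : ∀ k i j, testMatrix (inputArray (MvPolynomial.map (algebraMap ℚ ℝ) f)) n k i j
      = algebraMap ℚ ℝ (testMatrix (inputArray f) n k i j) := by
    intro k i j
    simp only [testMatrix, h2]
    split_ifs
    · rfl
    · rw [map_sum]
  have h4 : ∀ k, defect n (testMatrix (inputArray (MvPolynomial.map (algebraMap ℚ ℝ) f)) n k)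
      = fun i j => algebraMap ℚ ℝ (defect n (testMatrix (inputArray f) n k) i j) := by
    intro k
    funext i j
    simp only [defect, totalSum, rowSum, h3, map_sub, map_mul, map_sum]
  refine forall_congr' fun k => forall_congr' fun _ => ?_
  rw [h4, EliminationPasses, EliminationPasses]
  simp only [map_eliminate]
  simp
end Input

/-! ### A program logic for the machine -/

namespace ArithRAM

section Logic

variable {K : Type}

/-- All numbers in the memory have the property `G`. -/
def Memory.All (G : K → Prop) (s : Memory K) : Prop := ∀ a i j k, G (s.num a i j k)

@[simp] theorem Memory.write_idx (s : Memory K) (c : Cell) (x : K) : (s.write c x).idx = s.idx :=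
  rfl

@[simp] theorem Memory.write_num (s : Memory K) (c : Cell) (x : K) (a i j k : ℕ) :
    (s.write c x).num a i j k =
      if a = c.arr ∧ i = s.idx c.i ∧ j = s.idx c.j ∧ k = s.idx c.k then x else s.num a i j k :=
  rfl

@[simp] theorem Memory.setIdx_idx (s : Memory K) (r v q : ℕ) :
    (s.setIdx r v).idx q = if q = r then v else s.idx q :=
  rfl

@[simp] theorem Memory.setIdx_num (s : Memory K) (r v : ℕ) : (s.setIdx r v).num = s.num :=
  rfl

theorem Memory.All.write {G : K → Prop} {s : Memory K} (h : s.All G) (c : Cell) {x : K}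
    (hx : G x) : (s.write c x).All G := by
  intro a i j k
  rw [Memory.write_num]
  split_ifs
  · exact hx
  · exact h a i j k

variable [Field K] [LinearOrder K]

/-- The weakest precondition of a list of pieces of program, with time and a global invariant: started
on the memory `s`, in which all numbers have the property `G`, the machine executes `L` within `T`
steps, ends up in a memory with the property `Q`, and never holds a number without the property
`G` on the way. -/
def Wp (G : K → Prop) (L : List Program) (T : ℕ) (Q : Memory K → Prop) (s : Memory K) : Prop :=
  s.All G → ∃ t ≤ T, ∃ s' : Memory K, (∀ l, step^[t] ⟨L ++ l, s⟩ = ⟨l, s'⟩) ∧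
    (∀ l, ∀ u ≤ t, (step^[u] ⟨L ++ l, s⟩).mem.All G) ∧ Q s'

variable {G : K → Prop} {T T₁ T₂ : ℕ} {Q R : Memory K → Prop} {s : Memory K}
  {P P' : Program} {L : List Program}

theorem Wp.mono (h : Wp G L T Q s) (hT : T ≤ T₁) (hQ : ∀ s', Q s' → R s') : Wp G L T₁ R s :=
  fun hs => by
    obtain ⟨t, ht, s', h1, h2, h3⟩ := h hs
    exact ⟨t, ht.trans hT, s', h1, h2, hQ _ h3⟩

theorem Wp.of_le (h : Wp G L T Q s) (hT : T ≤ T₁) : Wp G L T₁ Q s :=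
  h.mono hT fun _ => id

theorem wp_nil (h : Q s) : Wp G [] 0 Q s := fun hs =>
  ⟨0, le_rfl, s, fun _ => rfl, fun l u hu => by
    obtain rfl := Nat.le_zero.1 hu
    exact hs, h⟩

/-- The postcondition of the first piece is the precondition of the others. -/
theorem wp_cons (h : Wp G [P] T₁ (fun s' => Wp G L T₂ Q s') s) :
    Wp G (P :: L) (T₁ + T₂) Q s := fun hs => by
  obtain ⟨t₁, ht₁, s₁, a1, a2, a3⟩ := h hs
  have hs₁ : s₁.All G := by
    have := a2 [] t₁ le_rfl
    rwa [a1] at this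
  obtain ⟨t₂, ht₂, s₂, b1, b2, b3⟩ := a3 hs₁
  refine ⟨t₁ + t₂, by omega, s₂, fun l => ?_, fun l u hu => ?_, b3⟩
  · rw [add_comm, Function.iterate_add_apply]
    exact (congrArg _ (a1 (L ++ l))).trans (b1 l)
  · rcases le_total u t₁ with h | h
    · exact a2 (L ++ l) u h
    · obtain ⟨v, rfl⟩ := Nat.exists_eq_add_of_le h
      rw [add_comm, Function.iterate_add_apply]
      have := b2 l v (by omega)
      rw [← a1 (L ++ l)] at this
      exact this

theorem wp_step {s' : Memory K} (hstep : ∀ l, step ⟨P :: l, s⟩ = ⟨L ++ l, s'⟩)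
    (hG : s.All G → s'.All G) (h : Wp G L T Q s') : Wp G [P] (T + 1) Q s := fun hs => by
  obtain ⟨t, ht, s₁, a1, a2, a3⟩ := h (hG hs)
  refine ⟨t + 1, by omega, s₁, fun l => ?_, fun l u hu => ?_, a3⟩
  · rw [Function.iterate_succ_apply]
    exact (congrArg _ (hstep l)).trans (a1 l)
  · cases u with
    | zero => exact hs
    | succ u =>
      rw [Function.iterate_succ_apply]
      have := a2 l u (by omega)
      rw [← hstep l] at this
      exact this

theorem wp_seq (h : Wp G [P] T₁ (fun s' => Wp G [P'] T₂ Q s') s) :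
    Wp G [.seq P P'] (T₁ + T₂ + 1) Q s :=
  wp_step (L := [P, P']) (fun _ => rfl) id (wp_cons h)

theorem wp_skip (h : Q s) : Wp G [.skip] 1 Q s :=
  wp_step (L := []) (fun _ => rfl) id (wp_nil h)

theorem wp_idxZero {r : ℕ} (h : Q (s.setIdx r 0)) : Wp G [.idxZero r] 1 Q s :=
  wp_step (L := []) (fun _ => rfl) id (wp_nil h)

theorem wp_idxSucc {r : ℕ} (h : Q (s.setIdx r (s.idx r + 1))) : Wp G [.idxSucc r] 1 Q s :=
  wp_step (L := []) (fun _ => rfl) id (wp_nil h)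

theorem wp_idxCopy {r q : ℕ} (h : Q (s.setIdx r (s.idx q))) : Wp G [.idxCopy r q] 1 Q s :=
  wp_step (L := []) (fun _ => rfl) id (wp_nil h)

theorem wp_const {c : Cell} {z : ℤ} (hG : G z) (h : Q (s.write c z)) : Wp G [.const c z] 1 Q s :=
  wp_step (L := []) (fun _ => rfl) (fun hs => hs.write c hG) (wp_nil h)

theorem wp_copy {c a : Cell} (h : Q (s.write c (s.read a))) : Wp G [.copy c a] 1 Q s :=
  wp_step (L := []) (fun _ => rfl) (fun hs => hs.write c (hs _ _ _ _)) (wp_nil h)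

theorem wp_arith {o : Op} {c a b : Cell} {x : K} (hx : o.eval (s.read a) (s.read b) = x)
    (hG : G x) (h : Q (s.write c x)) : Wp G [.arith o c a b] 1 Q s := by
  subst hx
  exact wp_step (L := []) (fun _ => rfl) (fun hs => hs.write c hG) (wp_nil h)

theorem wp_ite {b : Test} (h1 : b.eval s = true → Wp G [P] T Q s)
    (h2 : b.eval s = false → Wp G [P'] T Q s) : Wp G [.ite b P P'] (T + 1) Q s := by
  cases hb : b.eval s
  · exact wp_step (L := [P']) (fun l => by simp [step, hb]) id (h2 hb)
  · exact wp_step (L := [P]) (fun l => by simp [step, hb]) id (h1 hb)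

/-- Execute `P` if the index registers `r` and `q` hold the same number. -/
def ifEq (r q : ℕ) (P : Program) : Program :=
  .ite (.idxLt r q) .skip (.ite (.idxLt q r) .skip P)

theorem wp_ifEq {r q : ℕ} (h1 : s.idx r = s.idx q → Wp G [P] (T + 1) Q s)
    (h2 : s.idx r ≠ s.idx q → Q s) : Wp G [ifEq r q P] (T + 3) Q s := by
  refine wp_ite (fun hb => ?_) (fun hb => wp_ite (fun hb' => ?_) fun hb' => ?_)
  · exact (wp_skip (h2 (by simp [Test.eval] at hb; omega))).of_le (by omega)
  · exact (wp_skip (h2 (by simp [Test.eval] at hb'; omega))).of_le (by omega)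
  · exact h1 (by simp [Test.eval] at hb hb'; omega)

/-- Execute `P` with the index register `r` running through the numbers below the content of the
index register `b`. -/
def forLoop (r b : ℕ) (P : Program) : Program :=
  .seq (.idxZero r) (.while (.idxLt r b) (.seq P (.idxSucc r)))

/-- A loop with the invariant `Inv m` at the start of the round with `r = m`. Each round costs three
steps besides those of the body. -/
theorem wp_forLoop {r b N : ℕ} (Inv : ℕ → Memory K → Prop) (h0 : Inv 0 (s.setIdx r 0))
    (hInv : ∀ m s, Inv m s → s.idx r = m ∧ s.idx b = N)
    (hstep : ∀ m < N, ∀ s, Inv m s →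
      Wp G [P] T (fun s' => Inv (m + 1) (s'.setIdx r (s'.idx r + 1))) s)
    (hQ : ∀ s, Inv N s → Q s) :
    Wp G [forLoop r b P] (N * (T + 3) + 3) Q s := by
  have key : ∀ d m s, m + d = N → Inv m s →
      Wp G [.while (.idxLt r b) (.seq P (.idxSucc r))] (d * (T + 3) + 1) Q s := by
    intro d
    induction d with
    | zero =>
      intro m s hm hs
      obtain ⟨h1, h2⟩ := hInv m s hs
      refine (wp_step (L := []) (fun l => ?_) id (wp_nil (Q := Q) (s := s) ?_)).of_le (by omega)
      · have : ¬ s.idx r < s.idx b := by omega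
        simp [step, Test.eval, this]
      · obtain rfl : m = N := by omega
        exact hQ s hs
    | succ d ih =>
      intro m s hm hs
      obtain ⟨h1, h2⟩ := hInv m s hs
      have hlt : s.idx r < s.idx b := by omega
      refine (wp_step (L := [.seq P (.idxSucc r), .while (.idxLt r b) (.seq P (.idxSucc r))])
        (fun l => by simp [step, Test.eval, hlt]) id (wp_cons (wp_seq
          ((hstep m (by omega) s hs).mono le_rfl fun s' hs' => wp_idxSucc
            (ih (m + 1) _ (by omega) hs'))))).of_le ?_
      rw [Nat.succ_mul]
      omega
  exact (wp_seq (wp_idxZero (key N 0 _ (by omega) h0))).of_le (by omega)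

theorem step_iterate_nil (s : Memory K) (t : ℕ) : step^[t] ⟨[], s⟩ = ⟨[], s⟩ :=
  Function.iterate_fixed rfl t

/-- What a proof in the program logic says about the runs of a program. -/
theorem Wp.run (h : Wp G [P] T Q s) (hs : s.All G) :
    (run P s T).todo = [] ∧ Q (run P s T).mem ∧ ∀ t, (run P s t).mem.All G := by
  obtain ⟨t, ht, s', h1, h2, h3⟩ := h hs
  have h4 : ∀ u, t ≤ u → ArithRAM.run P s u = ⟨[], s'⟩ := by
    intro u hu
    obtain ⟨v, rfl⟩ := Nat.exists_eq_add_of_le hu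
    rw [ArithRAM.run, add_comm, Function.iterate_add_apply]
    exact (congrArg _ (h1 [])).trans (step_iterate_nil s' v)
  refine ⟨by rw [h4 T ht], by rw [h4 T ht]; exact h3, fun u => ?_⟩
  rcases le_total u t with hu | hu
  · exact h2 [] u hu
  · have := h2 [] t le_rfl
    rw [h4 u hu]
    rwa [h1] at this

end Logic

/-! ### The program -/

/-!
The index registers `0` and `2` hold `n` and `n + 1`, register `1` holds the answer, the registers
`3`, `4`, `5`, `6` run through `k`, `i`, `j`, `p`, register `7` holds `p + 1`, and register `8` holds
zero. The array `0` is the input, `1` holds the test matrices, `2` the total sum, `3` the row sums,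
`4` the stages of the elimination, `5` and `6` hold intermediate results, and `7` holds zero.
-/

/-- Set up the index registers. The answer is yes unless a test fails later. -/
def initProgram : Program :=
  .seq (.idxZero 1) <| .seq (.idxSucc 1) <| .seq (.idxCopy 2 0) <| .idxSucc 2

/-- Compute the third partial derivative at `(k, i, j)`, and add it to the entry at `(i, j)` of the last
test matrix, which is the matrix `n`. -/
def partialsBody : Program :=
  .seq (.copy ⟨5, 8, 8, 8⟩ ⟨0, 3, 4, 5⟩) <|
  .seq (ifEq 4 5 (.arith .add ⟨5, 8, 8, 8⟩ ⟨5, 8, 8, 8⟩ ⟨5, 8, 8, 8⟩)) <|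
  .seq (.copy ⟨6, 8, 8, 8⟩ ⟨5, 8, 8, 8⟩) <|
  .seq (ifEq 3 4 (.arith .add ⟨6, 8, 8, 8⟩ ⟨6, 8, 8, 8⟩ ⟨5, 8, 8, 8⟩)) <|
  .seq (ifEq 3 5 (.arith .add ⟨6, 8, 8, 8⟩ ⟨6, 8, 8, 8⟩ ⟨5, 8, 8, 8⟩)) <|
  .seq (.copy ⟨1, 3, 4, 5⟩ ⟨6, 8, 8, 8⟩) <|
  .arith .add ⟨1, 0, 4, 5⟩ ⟨1, 0, 4, 5⟩ ⟨6, 8, 8, 8⟩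

/-- Compute the test matrices. -/
def partialsProgram : Program := forLoop 3 0 (forLoop 4 0 (forLoop 5 0 partialsBody))

/-- Compute the row sums and the total sum of the test matrix `k`. -/
def sumsProgram : Program :=
  .seq (.const ⟨2, 8, 8, 8⟩ 0) <|
  forLoop 4 0 <|
    .seq (.const ⟨3, 4, 8, 8⟩ 0) <|
    .seq (forLoop 5 0 (.arith .add ⟨3, 4, 8, 8⟩ ⟨3, 4, 8, 8⟩ ⟨1, 3, 4, 5⟩)) <|
    .arith .add ⟨2, 8, 8, 8⟩ ⟨2, 8, 8, 8⟩ ⟨3, 4, 8, 8⟩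

/-- Compute the defect of the test matrix `k`. -/
def defectProgram : Program :=
  forLoop 4 0 <| forLoop 5 0 <|
    .seq (.arith .mul ⟨5, 8, 8, 8⟩ ⟨3, 4, 8, 8⟩ ⟨3, 5, 8, 8⟩) <|
    .seq (.arith .mul ⟨6, 8, 8, 8⟩ ⟨2, 8, 8, 8⟩ ⟨1, 3, 4, 5⟩) <|
    .arith .sub ⟨4, 8, 4, 5⟩ ⟨5, 8, 8, 8⟩ ⟨6, 8, 8, 8⟩

/-- Compute the stage `p + 1` of the elimination from the stage `p`. The stages are kept in separate
matrices, so that no entry is overwritten while it is still needed. -/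
def eliminateStep : Program :=
  forLoop 4 0 <| forLoop 5 0 <|
    .seq (.arith .mul ⟨5, 8, 8, 8⟩ ⟨4, 6, 4, 6⟩ ⟨4, 6, 6, 5⟩) <|
    .seq (.arith .div ⟨6, 8, 8, 8⟩ ⟨5, 8, 8, 8⟩ ⟨4, 6, 6, 6⟩) <|
    .arith .sub ⟨4, 7, 4, 5⟩ ⟨4, 6, 4, 5⟩ ⟨6, 8, 8, 8⟩

/-- Clear the answer if the test fails. -/
def require (b : Test) : Program := .ite b .skip (.idxZero 1)

/-- Perform the elimination and check the signs of the pivots. -/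
def eliminateProgram : Program :=
  forLoop 6 0 <|
    .seq (.idxCopy 7 6) <|
    .seq (.idxSucc 7) <|
    .seq (require (.numLe ⟨7, 8, 8, 8⟩ ⟨4, 6, 6, 6⟩)) <|
    eliminateStep

/-- Check that the elimination leaves nothing. -/
def checkZeroProgram : Program :=
  forLoop 4 0 <| forLoop 5 0 <|
    .seq (require (.numLe ⟨4, 0, 4, 5⟩ ⟨7, 8, 8, 8⟩)) <|
    require (.numLe ⟨7, 8, 8, 8⟩ ⟨4, 0, 4, 5⟩)

/-- The program that decides log concavity. -/
def logConcavityProgram : Program :=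
  .seq initProgram <| .seq partialsProgram <|
  forLoop 3 2 <|
    .seq sumsProgram <| .seq defectProgram <| .seq eliminateProgram checkZeroProgram

section Verification

variable {K : Type} [Field K]

/-- The registers and cells that the test of the matrix `k` does not touch, apart from the answer. -/
structure Frame (n : ℕ) (A : ℕ → ℕ → ℕ → K) (k : ℕ) (s : Memory K) : Prop where
  idx0 : s.idx 0 = n
  idx2 : s.idx 2 = n + 1
  idx3 : s.idx 3 = k
  idx8 : s.idx 8 = 0
  zero : s.num 7 0 0 0 = 0
  matrices : ∀ k ≤ n, ∀ i < n, ∀ j < n, s.num 1 k i j = A k i j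

/-- The answer register tells whether `V` holds. -/
def Answer (V : Prop) (s : Memory K) : Prop := (V → s.idx 1 = 1) ∧ (¬ V → s.idx 1 = 0)

omit [Field K] in
theorem Answer.congr {V W : Prop} {s : Memory K} (h : Answer V s) (hVW : V ↔ W) : Answer W s :=
  propext hVW ▸ h

theorem Frame.write {n : ℕ} {A : ℕ → ℕ → ℕ → K} {k : ℕ} {s : Memory K} (h : Frame n A k s)
    {c : Cell} (x : K) (h1 : c.arr ≠ 1) (h7 : c.arr ≠ 7) : Frame n A k (s.write c x) where
  idx0 := h.idx0
  idx2 := h.idx2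
  idx3 := h.idx3
  idx8 := h.idx8
  zero := by simp [h7.symm, h.zero]
  matrices := fun k hk i hi j hj => by simp [h1.symm, h.matrices k hk i hi j hj]

theorem Frame.setIdx {n : ℕ} {A : ℕ → ℕ → ℕ → K} {k : ℕ} {s : Memory K} (h : Frame n A k s)
    {r : ℕ} (v : ℕ) (h0 : r ≠ 0) (h2 : r ≠ 2) (h3 : r ≠ 3) (h8 : r ≠ 8) :
    Frame n A k (s.setIdx r v) where
  idx0 := by simp [h0.symm, h.idx0]
  idx2 := by simp [h2.symm, h.idx2]
  idx3 := by simp [h3.symm, h.idx3]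
  idx8 := by simp [h8.symm, h.idx8]
  zero := h.zero
  matrices := h.matrices

theorem Frame.congr {n : ℕ} {A : ℕ → ℕ → ℕ → K} {k : ℕ} {s s' : Memory K} (h : Frame n A k s)
    (hnum : s'.num = s.num) (hidx : ∀ q, q ≠ 1 → s'.idx q = s.idx q) : Frame n A k s' where
  idx0 := by rw [hidx 0 (by simp), h.idx0]
  idx2 := by rw [hidx 2 (by simp), h.idx2]
  idx3 := by rw [hidx 3 (by simp), h.idx3]
  idx8 := by rw [hidx 8 (by simp), h.idx8]
  zero := by rw [hnum, h.zero]
  matrices := by rw [hnum]; exact h.matrices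

omit [Field K] in
theorem Answer.write {V : Prop} {s : Memory K} (h : Answer V s) (c : Cell) (x : K) :
    Answer V (s.write c x) := h

omit [Field K] in
theorem Answer.setIdx {V : Prop} {s : Memory K} (h : Answer V s) {r : ℕ} (v : ℕ) (hr : r ≠ 1) :
    Answer V (s.setIdx r v) := by
  simpa [Answer, hr.symm] using h

variable [LinearOrder K] {G : K → Prop} {n : ℕ}

theorem wp_require {V : Prop} {b : Test} {s : Memory K} {Q : Memory K → Prop} (h : Answer V s)
    (hQ : ∀ s' : Memory K, s'.num = s.num → (∀ q, q ≠ 1 → s'.idx q = s.idx q) →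
      Answer (V ∧ b.eval s = true) s' → Q s') :
    Wp G [require b] 2 Q s := by
  refine wp_ite (fun hb => wp_skip (hQ s rfl (fun _ _ => rfl) (h.congr (by simp [hb]))))
    (fun hb => wp_idxZero (hQ _ rfl (fun q hq => by simp [hq]) ?_))
  exact ⟨fun h' => absurd h'.2 (by simp [hb]), fun _ => by simp⟩

section Sums

variable {A : ℕ → ℕ → ℕ → K} {k : ℕ} {V : Prop} {s : Memory K}

theorem wp_sumsProgram (hG0 : G 0)
    (hrow : ∀ i < n, ∀ m ≤ n, G (∑ j ∈ Finset.range m, A k i j))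
    (htot : ∀ m ≤ n, G (∑ i ∈ Finset.range m, rowSum n (A k) i)) (hk : k ≤ n)
    (hF : Frame n A k s) (hV : Answer V s) :
    Wp G [sumsProgram] (n * (n * 4 + 10) + 5)
      (fun s' => Frame n A k s' ∧ Answer V s' ∧ s'.num 2 0 0 0 = totalSum n (A k) ∧
        ∀ i < n, s'.num 3 i 0 0 = rowSum n (A k) i) s := by
  refine (wp_seq (wp_const (by simpa using hG0) (wp_forLoop (N := n) (T := n * 4 + 7)
    (fun m s' => Frame n A k s' ∧ Answer V s' ∧ s'.idx 4 = m ∧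
      s'.num 2 0 0 0 = ∑ i ∈ Finset.range m, rowSum n (A k) i ∧
      ∀ i < m, s'.num 3 i 0 0 = rowSum n (A k) i)
    ?_ (fun m s h => ⟨h.2.2.1, h.1.idx0⟩) (fun m hm s h => ?_)
    (fun s h => ⟨h.1, h.2.1, h.2.2.2⟩)))).of_le (le_of_eq (by ring))
  · refine ⟨(hF.write _ (by simp) (by simp)).setIdx _ (by simp) (by simp) (by simp) (by simp),
      (hV.write _ _).setIdx _ (by simp), by simp, by simp [hF.idx8], by simp⟩
  · obtain ⟨hF, hV, h4, h2, h3⟩ := h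
    refine (wp_seq (T₁ := 1) (T₂ := n * 4 + 5) (wp_const (by simpa using hG0)
      (wp_seq (T₁ := n * (1 + 3) + 3) (T₂ := 1) (wp_forLoop (N := n) (T := 1)
      (fun m' s' => Frame n A k s' ∧ Answer V s' ∧ s'.idx 4 = m ∧ s'.idx 5 = m' ∧
        s'.num 2 0 0 0 = ∑ i ∈ Finset.range m, rowSum n (A k) i ∧
        (∀ i < m, s'.num 3 i 0 0 = rowSum n (A k) i) ∧
        s'.num 3 m 0 0 = ∑ j ∈ Finset.range m', A k m j)
      ?_ (fun m s h => ⟨h.2.2.2.1, h.1.idx0⟩) (fun m' hm' s h => ?_)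
      (fun s h => ?_))))).of_le (by omega)
    · refine ⟨(hF.write _ (by simp) (by simp)).setIdx _ (by simp) (by simp) (by simp) (by simp),
        (hV.write _ _).setIdx _ (by simp), by simp [h4], by simp, by simp [h2], ?_, ?_⟩
      · intro i hi
        simp [h4, hi.ne, h3 i hi]
      · simp [h4, hF.idx8]
    · obtain ⟨hF, hV, h4, h5, h2, h3, h3'⟩ := h
      have hx : s.num 3 m 0 0 + s.num 1 k m m' = ∑ j ∈ Finset.range (m' + 1), A k m j := by
        rw [h3', hF.matrices k hk m hm m' hm', Finset.sum_range_succ]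
      refine wp_arith (x := ∑ j ∈ Finset.range (m' + 1), A k m j)
        (by simpa [Memory.read, Op.eval, h4, h5, hF.idx8, hF.idx3] using hx)
        (hrow m hm _ hm') ?_
      refine ⟨(hF.write _ (by simp) (by simp)).setIdx _ (by simp) (by simp) (by simp) (by simp),
        (hV.write _ _).setIdx _ (by simp), by simp [h4], by simp [h5], by simp [h2], ?_, ?_⟩
      · intro i hi
        simp [h4, hi.ne, h3 i hi]
      · simp [h4, hF.idx8]
    · obtain ⟨hF, hV, h4, h5, h2, h3, h3'⟩ := h
      have hx : s.num 2 0 0 0 + s.num 3 m 0 0 = ∑ i ∈ Finset.range (m + 1), rowSum n (A k) i := by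
        rw [h2, h3', Finset.sum_range_succ, rowSum]
      refine wp_arith (x := ∑ i ∈ Finset.range (m + 1), rowSum n (A k) i)
        (by simpa [Memory.read, Op.eval, h4, h5, hF.idx8, hF.idx3] using hx)
        (htot _ hm) ?_
      refine ⟨(hF.write _ (by simp) (by simp)).setIdx _ (by simp) (by simp) (by simp) (by simp),
        (hV.write _ _).setIdx _ (by simp), by simp [h4], by simp [hF.idx8], ?_⟩
      intro i hi
      rcases Nat.lt_succ_iff_lt_or_eq.1 hi with hi | rfl
      · simp [h3 i hi]
      · simp [h3', rowSum]

end Sums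

section Defect

variable {A : ℕ → ℕ → ℕ → K} {k : ℕ} {V : Prop} {s : Memory K}

/-- A double loop over `i, j < n` that fills the matrix `p` of the array `4`. -/
theorem wp_fill {B : Program} {p : ℕ} {X : ℕ → ℕ → K} {T : ℕ} (J : Memory K → Prop)
    (hJ : ∀ s v r, r = 4 ∨ r = 5 → J s → J (s.setIdx r v)) (hJ0 : ∀ s, J s → s.idx 0 = n)
    (hB : ∀ i < n, ∀ j < n, ∀ s, J s → s.idx 4 = i → s.idx 5 = j →
      Wp G [B] T (fun s' => J s' ∧ s'.idx 4 = i ∧ s'.idx 5 = j ∧ s'.num 4 p i j = X i j ∧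
        ∀ i' j', ¬ (i' = i ∧ j' = j) → s'.num 4 p i' j' = s.num 4 p i' j') s)
    (hs : J s) :
    Wp G [forLoop 4 0 (forLoop 5 0 B)] (n * (n * (T + 3) + 6) + 3)
      (fun s' => J s' ∧ ∀ i < n, ∀ j < n, s'.num 4 p i j = X i j) s := by
  refine (wp_forLoop (N := n) (T := n * (T + 3) + 3)
    (fun m s' => J s' ∧ s'.idx 4 = m ∧ ∀ i < m, ∀ j < n, s'.num 4 p i j = X i j)
    ⟨hJ _ _ _ (by simp) hs, by simp, by simp⟩
    (fun m s h => ⟨h.2.1, hJ0 s h.1⟩) (fun m hm s h => ?_) fun s h => ⟨h.1, h.2.2⟩).of_le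
      (by simp [add_assoc])
  obtain ⟨hs, h4, hX⟩ := h
  refine wp_forLoop (N := n)
    (fun m' s' => J s' ∧ s'.idx 4 = m ∧ s'.idx 5 = m' ∧
      (∀ i < m, ∀ j < n, s'.num 4 p i j = X i j) ∧ ∀ j < m', s'.num 4 p m j = X m j)
    ⟨hJ _ _ _ (by simp) hs, by simp [h4], by simp, hX, by simp⟩
    (fun m s h => ⟨h.2.2.1, hJ0 s h.1⟩) (fun m' hm' s h => ?_) fun s h => ?_
  · obtain ⟨hs, h4, h5, hX, hX'⟩ := h
    refine (hB m hm m' hm' s hs h4 h5).mono le_rfl fun s' h => ?_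
    obtain ⟨hs', h4', h5', hx, hsame⟩ := h
    refine ⟨hJ _ _ _ (by simp) hs', by simp [h4'], by simp [h5'], fun i hi j hj => ?_,
      fun j hj => ?_⟩
    · rw [Memory.setIdx_num, hsame i j (by omega), hX i hi j hj]
    · rw [Memory.setIdx_num]
      rcases Nat.lt_succ_iff_lt_or_eq.1 hj with hj | rfl
      · rw [hsame m j (by omega), hX' j hj]
      · exact hx
  · obtain ⟨hs, h4, h5, hX, hX'⟩ := h
    refine ⟨hJ _ _ _ (by simp) hs, by simp [h4], fun i hi j hj => ?_⟩
    rw [Memory.setIdx_num]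
    rcases Nat.lt_succ_iff_lt_or_eq.1 hi with hi | rfl
    · exact hX i hi j hj
    · exact hX' j hj

theorem wp_defectProgram (h1 : ∀ i < n, ∀ j < n, G (rowSum n (A k) i * rowSum n (A k) j))
    (h2 : ∀ i < n, ∀ j < n, G (totalSum n (A k) * A k i j))
    (h3 : ∀ i < n, ∀ j < n, G (defect n (A k) i j)) (hk : k ≤ n)
    (hF : Frame n A k s) (hV : Answer V s) (htot : s.num 2 0 0 0 = totalSum n (A k))
    (hrow : ∀ i < n, s.num 3 i 0 0 = rowSum n (A k) i) :
    Wp G [defectProgram] (n * (n * 8 + 6) + 3)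
      (fun s' => (Frame n A k s' ∧ Answer V s') ∧
        ∀ i < n, ∀ j < n, s'.num 4 0 i j = defect n (A k) i j) s := by
  refine (wp_fill (T := 5) (p := 0) (X := defect n (A k)) (fun s => Frame n A k s ∧ Answer V s ∧
    s.num 2 0 0 0 = totalSum n (A k) ∧ ∀ i < n, s.num 3 i 0 0 = rowSum n (A k) i) ?_
    (fun s h => h.1.idx0) ?_ ⟨hF, hV, htot, hrow⟩).mono le_rfl
    fun s h => ⟨⟨h.1.1, h.1.2.1⟩, h.2⟩
  · rintro s v r hr ⟨hF, hV, h⟩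
    exact ⟨hF.setIdx _ (by omega) (by omega) (by omega) (by omega), hV.setIdx _ (by omega), h⟩
  · rintro i hi j hj s ⟨hF, hV, htot, hrow⟩ h4 h5
    refine wp_seq (T₁ := 1) (T₂ := 3) (wp_arith (x := rowSum n (A k) i * rowSum n (A k) j) ?_
      (h1 i hi j hj) (wp_seq (T₁ := 1) (T₂ := 1) (wp_arith (x := totalSum n (A k) * A k i j) ?_
      (h2 i hi j hj) (wp_arith (x := defect n (A k) i j) ?_ (h3 i hi j hj) ?_))))
    · simp [Memory.read, Op.eval, h4, h5, hF.idx8, hrow i hi, hrow j hj]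
    · simp [Memory.read, Op.eval, h4, h5, hF.idx8, hF.idx3, htot, hF.matrices k hk i hi j hj]
    · simp [Memory.read, Op.eval, hF.idx8, defect]
    · refine ⟨⟨((hF.write _ (by simp) (by simp)).write _ (by simp) (by simp)).write _ (by simp)
        (by simp), hV, by simp [htot], fun i hi => by simp [hrow i hi]⟩, h4, h5,
        by simp [h4, h5, hF.idx8], fun i' j' hne => ?_⟩
      simp [h4, h5, hF.idx8, hne]

end Defect

section Eliminate

variable {A : ℕ → ℕ → ℕ → K} {k : ℕ} {V : Prop} {s : Memory K} {M : ℕ → ℕ → K}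

theorem wp_eliminateStep {p : ℕ} (hp : p < n)
    (h1 : ∀ i < n, ∀ j < n, G (eliminate M p i p * eliminate M p p j))
    (h2 : ∀ i < n, ∀ j < n, G (eliminate M p i p * eliminate M p p j / eliminate M p p p))
    (h3 : ∀ i < n, ∀ j < n, G (eliminate M (p + 1) i j))
    (hF : Frame n A k s) (hV : Answer V s) (h6 : s.idx 6 = p) (h7 : s.idx 7 = p + 1)
    (hM : ∀ i < n, ∀ j < n, s.num 4 p i j = eliminate M p i j) :
    Wp G [eliminateStep] (n * (n * 8 + 6) + 3)
      (fun s' => (Frame n A k s' ∧ Answer V s' ∧ s'.idx 6 = p) ∧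
        ∀ i < n, ∀ j < n, s'.num 4 (p + 1) i j = eliminate M (p + 1) i j) s := by
  refine (wp_fill (T := 5) (p := p + 1) (X := eliminate M (p + 1))
    (fun s => Frame n A k s ∧ Answer V s ∧ s.idx 6 = p ∧ s.idx 7 = p + 1 ∧
      ∀ i < n, ∀ j < n, s.num 4 p i j = eliminate M p i j) ?_
    (fun s h => h.1.idx0) ?_ ⟨hF, hV, h6, h7, hM⟩).mono le_rfl
    fun s h => ⟨⟨h.1.1, h.1.2.1, h.1.2.2.1⟩, h.2⟩
  · rintro s v r hr ⟨hF, hV, h6, h7, hM⟩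
    refine ⟨hF.setIdx _ (by omega) (by omega) (by omega) (by omega), hV.setIdx _ (by omega),
      ?_, ?_, hM⟩
    · rw [Memory.setIdx_idx, if_neg (by omega), h6]
    · rw [Memory.setIdx_idx, if_neg (by omega), h7]
  · rintro i hi j hj s ⟨hF, hV, h6, h7, hM⟩ h4 h5
    refine wp_seq (T₁ := 1) (T₂ := 3)
      (wp_arith (x := eliminate M p i p * eliminate M p p j) ?_
      (h1 i hi j hj) (wp_seq (T₁ := 1) (T₂ := 1)
      (wp_arith (x := eliminate M p i p * eliminate M p p j / eliminate M p p p) ?_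
      (h2 i hi j hj) (wp_arith (x := eliminate M (p + 1) i j) ?_ (h3 i hi j hj) ?_))))
    · simp [Memory.read, Op.eval, h4, h5, h6, hM i hi p hp, hM p hp j hj]
    · simp [Memory.read, Op.eval, h6, hF.idx8, hM p hp p hp]
    · simp [Memory.read, Op.eval, h4, h5, h6, hF.idx8, hM i hi j hj, eliminate]
    · refine ⟨⟨((hF.write _ (by simp) (by simp)).write _ (by simp) (by simp)).write _ (by simp)
        (by simp), hV, h6, h7, fun i' hi' j' hj' => ?_⟩, h4, h5,
        by simp [h4, h5, h7], fun i' j' hne => ?_⟩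
      · simp [h7, hM i' hi' j' hj']
      · simp [h4, h5, h7, hne]

theorem wp_eliminateProgram
    (h1 : ∀ p < n, ∀ i < n, ∀ j < n, G (eliminate M p i p * eliminate M p p j))
    (h2 : ∀ p < n, ∀ i < n, ∀ j < n,
      G (eliminate M p i p * eliminate M p p j / eliminate M p p p))
    (h3 : ∀ p < n, ∀ i < n, ∀ j < n, G (eliminate M (p + 1) i j))
    (hF : Frame n A k s) (hV : Answer V s)
    (hM : ∀ i < n, ∀ j < n, s.num 4 0 i j = M i j) :
    Wp G [eliminateProgram] (n * (n * (n * 8 + 6) + 13) + 3)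
      (fun s' => (Frame n A k s' ∧ Answer (V ∧ ∀ p < n, 0 ≤ eliminate M p p p) s') ∧
        ∀ i < n, ∀ j < n, s'.num 4 n i j = eliminate M n i j) s := by
  refine (wp_forLoop (N := n) (T := n * (n * 8 + 6) + 10)
    (fun m s' => Frame n A k s' ∧ Answer (V ∧ ∀ p < m, 0 ≤ eliminate M p p p) s' ∧
      s'.idx 6 = m ∧ ∀ i < n, ∀ j < n, s'.num 4 m i j = eliminate M m i j)
    ⟨hF.setIdx _ (by simp) (by simp) (by simp) (by simp),
      (hV.congr (by simp)).setIdx _ (by simp), by simp, hM⟩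
    (fun m s h => ⟨h.2.2.1, h.1.idx0⟩) (fun m hm s h => ?_)
    fun s h => ⟨⟨h.1, h.2.1⟩, h.2.2.2⟩).of_le le_rfl
  obtain ⟨hF, hV, h6, hM⟩ := h
  have hF' := (hF.setIdx (r := 7) (s.idx 6) (by simp) (by simp) (by simp) (by simp)).setIdx (r := 7)
    (s.idx 6 + 1) (by simp) (by simp) (by simp) (by simp)
  refine (wp_seq (T₁ := 1) (T₂ := 1 + (2 + (n * (n * 8 + 6) + 3) + 1) + 1) (wp_idxCopy
    (wp_seq (T₁ := 1) (T₂ := 2 + (n * (n * 8 + 6) + 3) + 1) (wp_idxSucc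
    (wp_seq (T₁ := 2) (T₂ := n * (n * 8 + 6) + 3) (wp_require
    ((hV.setIdx (r := 7) _ (by simp)).setIdx (r := 7) _ (by simp))
    fun s' hnum hidx hV' => ?_)))))).of_le (by omega)
  have h6' : s'.idx 6 = m := by rw [hidx 6 (by simp)]; simp [h6]
  have h7' : s'.idx 7 = m + 1 := by rw [hidx 7 (by simp)]; simp [h6]
  have hM' : ∀ i < n, ∀ j < n, s'.num 4 m i j = eliminate M m i j := by
    rw [hnum]
    exact hM
  refine (wp_eliminateStep (M := M) hm (h1 m hm) (h2 m hm) (h3 m hm)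
    (hF'.congr hnum fun q hq => (hidx q hq).trans (by simp)) hV' h6' h7' hM').mono le_rfl
    fun s'' h => ?_
  obtain ⟨⟨hF'', hV'', h6''⟩, hM''⟩ := h
  refine ⟨hF''.setIdx _ (by simp) (by simp) (by simp) (by simp),
    (hV''.congr ?_).setIdx _ (by simp), by simp [h6''], hM''⟩
  rw [Nat.forall_lt_succ_right]
  simp [Test.eval, Memory.read, hF.idx8, hF.zero, h6, hM m hm m hm, and_assoc]

theorem wp_checkZeroProgram {E : ℕ → ℕ → K} (hF : Frame n A k s) (hV : Answer V s)
    (hE : ∀ i < n, ∀ j < n, s.num 4 n i j = E i j) :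
    Wp G [checkZeroProgram] (n * (n * 8 + 6) + 3)
      (fun s' => Frame n A k s' ∧ Answer (V ∧ ∀ i < n, ∀ j < n, E i j = 0) s') s := by
  refine (wp_forLoop (N := n) (T := n * 8 + 3)
    (fun m s' => Frame n A k s' ∧ Answer (V ∧ ∀ i < m, ∀ j < n, E i j = 0) s' ∧
      s'.idx 4 = m ∧ ∀ i < n, ∀ j < n, s'.num 4 n i j = E i j)
    ⟨hF.setIdx _ (by simp) (by simp) (by simp) (by simp),
      (hV.congr (by simp)).setIdx _ (by simp), by simp, hE⟩
    (fun m s h => ⟨h.2.2.1, h.1.idx0⟩) (fun m hm s h => ?_)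
    fun s h => ⟨h.1, h.2.1⟩).of_le (le_of_eq (by ring))
  obtain ⟨hF, hV, h4, hE⟩ := h
  refine wp_forLoop (N := n) (T := 5)
    (fun m' s' => Frame n A k s' ∧
      Answer ((V ∧ ∀ i < m, ∀ j < n, E i j = 0) ∧ ∀ j < m', E m j = 0) s' ∧
      s'.idx 4 = m ∧ s'.idx 5 = m' ∧ ∀ i < n, ∀ j < n, s'.num 4 n i j = E i j)
    ⟨hF.setIdx _ (by simp) (by simp) (by simp) (by simp),
      (hV.congr (by simp)).setIdx _ (by simp), by simp [h4], by simp, hE⟩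
    (fun m s h => ⟨h.2.2.2.1, h.1.idx0⟩) (fun m' hm' s h => ?_) fun s h => ?_
  · obtain ⟨hF, hV, h4, h5, hE⟩ := h
    refine wp_seq (T₁ := 2) (T₂ := 2) (wp_require hV fun s₁ hnum₁ hidx₁ hV₁ =>
      wp_require hV₁ fun s₂ hnum₂ hidx₂ hV₂ => ?_)
    have hnum : s₂.num = s.num := hnum₂.trans hnum₁
    have hidx : ∀ q, q ≠ 1 → s₂.idx q = s.idx q := fun q hq => (hidx₂ q hq).trans (hidx₁ q hq)
    refine ⟨(hF.congr hnum hidx).setIdx _ (by simp) (by simp) (by simp) (by simp),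
      (hV₂.congr ?_).setIdx _ (by simp), by simp [hidx, h4], by simp [hidx, h5],
      by simpa [hnum] using hE⟩
    rw [Nat.forall_lt_succ_right, le_antisymm_iff (a := E m m')]
    simp [Test.eval, Memory.read, hnum₁, hidx₁, hF.idx8, hF.zero, hF.idx0, h4, h5,
      hE m hm m' hm', and_assoc]
  · obtain ⟨hF, hV, h4, h5, hE⟩ := h
    refine ⟨hF.setIdx _ (by simp) (by simp) (by simp) (by simp),
      (hV.congr ?_).setIdx _ (by simp), by simp [h4], hE⟩
    rw [Nat.forall_lt_succ_right, and_assoc]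

end Eliminate

end Verification

section Partials

variable {K : Type} [Field K]

/-- The memory during the computation of the test matrices, apart from the array of these. -/
structure InputFrame (n : ℕ) (c : ℕ → ℕ → ℕ → K) (s : Memory K) : Prop where
  idx0 : s.idx 0 = n
  idx1 : s.idx 1 = 1
  idx2 : s.idx 2 = n + 1
  idx8 : s.idx 8 = 0
  zero : s.num 7 0 0 0 = 0
  input : ∀ k i j, s.num 0 k i j = c k i j

theorem InputFrame.write {n : ℕ} {c : ℕ → ℕ → ℕ → K} {s : Memory K} (h : InputFrame n c s)
    {d : Cell} (x : K) (h0 : d.arr ≠ 0) (h7 : d.arr ≠ 7) : InputFrame n c (s.write d x) where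
  idx0 := h.idx0
  idx1 := h.idx1
  idx2 := h.idx2
  idx8 := h.idx8
  zero := by simp [h7.symm, h.zero]
  input := by simp [h0.symm, h.input]

theorem InputFrame.setIdx {n : ℕ} {c : ℕ → ℕ → ℕ → K} {s : Memory K} (h : InputFrame n c s)
    {r : ℕ} (v : ℕ) (h0 : r ≠ 0) (h1 : r ≠ 1) (h2 : r ≠ 2) (h8 : r ≠ 8) :
    InputFrame n c (s.setIdx r v) where
  idx0 := by simp [h0.symm, h.idx0]
  idx1 := by simp [h1.symm, h.idx1]
  idx2 := by simp [h2.symm, h.idx2]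
  idx8 := by simp [h8.symm, h.idx8]
  zero := h.zero
  input := h.input

variable [LinearOrder K] {G : K → Prop} {n : ℕ} {c : ℕ → ℕ → ℕ → K} {s : Memory K}

theorem wp_partialsBody {k i j : ℕ} (hG1 : G (doubledEntry c k i j))
    (hG2 : G (doubledEntry c k i j + if k = i then doubledEntry c k i j else 0))
    (hG3 : G (partialEntry c k i j))
    (hG4 : G (∑ l ∈ Finset.range (k + 1), partialEntry c l i j)) (hk : k < n)
    (hF : InputFrame n c s) (h3 : s.idx 3 = k) (h4 : s.idx 4 = i) (h5 : s.idx 5 = j)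
    (hsum : s.num 1 n i j = ∑ l ∈ Finset.range k, partialEntry c l i j) :
    Wp G [partialsBody] 19
      (fun s' => InputFrame n c s' ∧ s'.idx 3 = k ∧ s'.idx 4 = i ∧ s'.idx 5 = j ∧
        s'.num 1 k i j = partialEntry c k i j ∧
        s'.num 1 n i j = ∑ l ∈ Finset.range (k + 1), partialEntry c l i j ∧
        ∀ k' i' j', ¬ ((k' = k ∨ k' = n) ∧ i' = i ∧ j' = j) →
          s'.num 1 k' i' j' = s.num 1 k' i' j') s := by
  -- what the intermediate results do not change
  set J : Memory K → Prop := fun s' =>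
    InputFrame n c s' ∧ s'.idx 3 = k ∧ s'.idx 4 = i ∧ s'.idx 5 = j ∧ s'.num 1 = s.num 1
  have hJw : ∀ (s' : Memory K) (d : Cell) (x : K), J s' → d.arr ≠ 0 → d.arr ≠ 1 → d.arr ≠ 7 →
      J (s'.write d x) := by
    rintro s' d x ⟨hF, h3, h4, h5, h1⟩ q0 q1 q7
    refine ⟨hF.write x q0 q7, h3, h4, h5, ?_⟩
    funext k' i' j'
    simp [q1.symm, h1]
  refine wp_seq (T₁ := 1) (T₂ := 17) (wp_copy (wp_seq (T₁ := 3) (T₂ := 13) (Wp.mono (T := 3)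
    (Q := fun s' => J s' ∧ s'.num 5 0 0 0 = doubledEntry c k i j) (wp_ifEq (T := 0) ?_ ?_) le_rfl
    fun s₁ hs₁ => wp_seq (T₁ := 1) (T₂ := 11) (wp_copy (wp_seq (T₁ := 3) (T₂ := 7) (Wp.mono (T := 3)
    (Q := fun s' => J s' ∧ s'.num 5 0 0 0 = doubledEntry c k i j ∧ s'.num 6 0 0 0
      = doubledEntry c k i j + if k = i then doubledEntry c k i j else 0)
    (wp_ifEq (T := 0) ?_ ?_) le_rfl
    fun s₂ hs₂ => wp_seq (T₁ := 3) (T₂ := 3) (Wp.mono (T := 3)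
    (Q := fun s' => J s' ∧ s'.num 6 0 0 0 = partialEntry c k i j)
    (wp_ifEq (T := 0) ?_ ?_) le_rfl
    fun s₃ hs₃ => wp_seq (T₁ := 1) (T₂ := 1) (wp_copy (wp_arith
      (x := ∑ l ∈ Finset.range (k + 1), partialEntry c l i j) ?_ hG4 ?_)))))))))
  · intro he
    have he : i = j := by simpa [h4, h5] using he
    refine wp_arith (x := doubledEntry c k i j) ?_ hG1
      ⟨hJw _ _ _ (hJw _ _ _ ⟨hF, h3, h4, h5, rfl⟩ ?_ ?_ ?_) ?_ ?_ ?_, ?_⟩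
    · simp [Memory.read, Op.eval, doubledEntry, he, hF.idx8, h3, h4, h5, hF.input]
    all_goals simp [hF.idx8]
  · intro he
    have he : i ≠ j := by simpa [h4, h5] using he
    refine ⟨hJw _ _ _ ⟨hF, h3, h4, h5, rfl⟩ ?_ ?_ ?_, ?_⟩
    · simp
    · simp
    · simp
    · simp [Memory.read, doubledEntry, he, hF.idx8, h3, h4, h5, hF.input]
  · intro he
    obtain ⟨⟨hF, h3, h4, h5, h1⟩, ht⟩ := hs₁
    have he : k = i := by simpa [h3, h4] using he
    refine wp_arith (x := doubledEntry c k i j + if k = i then doubledEntry c k i j else 0) ?_ hG2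
      ⟨hJw _ _ _ (hJw _ _ _ ⟨hF, h3, h4, h5, h1⟩ ?_ ?_ ?_) ?_ ?_ ?_, ?_⟩
    · simp [Memory.read, Op.eval, he, hF.idx8]
      rw [ht, he]
    all_goals simp [hF.idx8, ht]
  · intro he
    obtain ⟨⟨hF, h3, h4, h5, h1⟩, ht⟩ := hs₁
    have he : k ≠ i := by simpa [h3, h4] using he
    refine ⟨hJw _ _ _ ⟨hF, h3, h4, h5, h1⟩ ?_ ?_ ?_, ?_⟩
    · simp
    · simp
    · simp
    · simp [Memory.read, he, hF.idx8, ht]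
  · intro he
    obtain ⟨⟨hF, h3, h4, h5, h1⟩, ht, hu⟩ := hs₂
    have he : k = j := by simpa [h3, h5] using he
    refine wp_arith (x := partialEntry c k i j) ?_ hG3
      ⟨hJw _ _ _ ⟨hF, h3, h4, h5, h1⟩ ?_ ?_ ?_, ?_⟩
    · simp only [Memory.read, Op.eval, hF.idx8, ht, hu, partialEntry]
      rw [if_pos he]
    all_goals simp [hF.idx8]
  · intro he
    obtain ⟨⟨hF, h3, h4, h5, h1⟩, ht, hu⟩ := hs₂
    have he : k ≠ j := by simpa [h3, h5] using he
    refine ⟨⟨hF, h3, h4, h5, h1⟩, ?_⟩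
    rw [hu, partialEntry, if_neg he, add_zero]
  · obtain ⟨⟨hF, h3, h4, h5, h1⟩, hu⟩ := hs₃
    simp [Memory.read, Op.eval, hF.idx8, hF.idx0, h3, h4, h5, hu, h1, hsum, hk.ne',
      Finset.sum_range_succ]
  · obtain ⟨⟨hF, h3, h4, h5, h1⟩, hu⟩ := hs₃
    refine ⟨(hF.write _ (by simp) (by simp)).write _ (by simp) (by simp), h3, h4, h5, ?_, ?_, ?_⟩
    · simp [Memory.read, hF.idx8, hF.idx0, h3, h4, h5, hu, hk.ne]
    · simp [hF.idx0, h4, h5]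
    · intro k' i' j' hne
      simp only [Memory.write_num, Memory.write_idx, h3, h4, h5, hF.idx0, h1]
      rw [if_neg (by tauto), if_neg (by tauto)]

/-- The contents of the array of test matrices when the loops over `k`, `i`, `j` have reached a
position. -/
def MatricesUpTo (n : ℕ) (c : ℕ → ℕ → ℕ → K) (k i j : ℕ) (s : Memory K) : Prop :=
  (∀ k' < n, ∀ i' < n, ∀ j' < n, (k' < k ∨ k' = k ∧ (i' < i ∨ i' = i ∧ j' < j)) →
    s.num 1 k' i' j' = partialEntry c k' i' j') ∧
  (∀ i' < n, ∀ j' < n, (i' < i ∨ i' = i ∧ j' < j) →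
    s.num 1 n i' j' = ∑ l ∈ Finset.range (k + 1), partialEntry c l i' j') ∧
  ∀ i' < n, ∀ j' < n, ¬ (i' < i ∨ i' = i ∧ j' < j) →
    s.num 1 n i' j' = ∑ l ∈ Finset.range k, partialEntry c l i' j'

omit [LinearOrder K] in
theorem MatricesUpTo.next_row {k i : ℕ} (h : MatricesUpTo n c k i n s) :
    MatricesUpTo n c k (i + 1) 0 s := by
  refine ⟨fun k' hk' i' hi' j' hj' hb => h.1 k' hk' i' hi' j' hj' (by omega),
    fun i' hi' j' hj' hb => h.2.1 i' hi' j' hj' (by omega),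
    fun i' hi' j' hj' hb => h.2.2 i' hi' j' hj' (by omega)⟩

omit [LinearOrder K] in
theorem MatricesUpTo.next_slice {k : ℕ} (h : MatricesUpTo n c k n 0 s) :
    MatricesUpTo n c (k + 1) 0 0 s := by
  refine ⟨fun k' hk' i' hi' j' hj' hb => h.1 k' hk' i' hi' j' hj' (by omega),
    fun i' hi' j' hj' hb => by omega,
    fun i' hi' j' hj' hb => h.2.1 i' hi' j' hj' (by omega)⟩

theorem wp_partialsProgram (hG1 : ∀ k < n, ∀ i < n, ∀ j < n, G (doubledEntry c k i j))
    (hG2 : ∀ k < n, ∀ i < n, ∀ j < n,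
      G (doubledEntry c k i j + if k = i then doubledEntry c k i j else 0))
    (hG3 : ∀ k < n, ∀ i < n, ∀ j < n, G (partialEntry c k i j))
    (hG4 : ∀ m ≤ n, ∀ i < n, ∀ j < n, G (∑ l ∈ Finset.range m, partialEntry c l i j))
    (hF : InputFrame n c s) (h1 : ∀ i j, s.num 1 n i j = 0) :
    Wp G [partialsProgram] (n * (n * (n * 22 + 6) + 6) + 3)
      (fun s' => InputFrame n c s' ∧
        ∀ k ≤ n, ∀ i < n, ∀ j < n, s'.num 1 k i j = testMatrix c n k i j) s := by
  refine (wp_forLoop (N := n) (T := n * (n * 22 + 6) + 3)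
    (fun k s' => InputFrame n c s' ∧ s'.idx 3 = k ∧ MatricesUpTo n c k 0 0 s')
    ⟨hF.setIdx _ (by simp) (by simp) (by simp) (by simp), by simp, ?_⟩
    (fun m s h => ⟨h.2.1, h.1.idx0⟩) (fun k hk s h => ?_) fun s h => ?_).of_le
      (le_of_eq (by ring))
  · exact ⟨fun _ _ _ _ _ _ _ => by omega, fun _ _ _ _ _ => by omega, fun i' _ j' _ _ => by simp [h1]⟩
  · obtain ⟨hF, h3, hM⟩ := h
    refine (wp_forLoop (N := n) (T := n * 22 + 3)
      (fun i s' => InputFrame n c s' ∧ s'.idx 3 = k ∧ s'.idx 4 = i ∧ MatricesUpTo n c k i 0 s')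
      ⟨hF.setIdx _ (by simp) (by simp) (by simp) (by simp), by simp [h3], by simp, hM⟩
      (fun m s h => ⟨h.2.2.1, h.1.idx0⟩) (fun i hi s h => ?_) fun s h => ?_).of_le
        (le_of_eq (by ring))
    · obtain ⟨hF, h3, h4, hM⟩ := h
      refine wp_forLoop (N := n) (T := 19)
        (fun j s' => InputFrame n c s' ∧ s'.idx 3 = k ∧ s'.idx 4 = i ∧ s'.idx 5 = j ∧
          MatricesUpTo n c k i j s')
        ⟨hF.setIdx _ (by simp) (by simp) (by simp) (by simp), by simp [h3], by simp [h4], by simp,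
          hM⟩
        (fun m s h => ⟨h.2.2.2.1, h.1.idx0⟩) (fun j hj s h => ?_) fun s h => ?_
      · obtain ⟨hF, h3, h4, h5, hM⟩ := h
        refine (wp_partialsBody (hG1 k hk i hi j hj) (hG2 k hk i hi j hj) (hG3 k hk i hi j hj)
          (hG4 (k + 1) hk i hi j hj) hk hF h3 h4 h5
          (hM.2.2 i hi j hj (by omega))).mono le_rfl fun s' h => ?_
        obtain ⟨hF', h3', h4', h5', e1, e2, e3⟩ := h
        refine ⟨hF'.setIdx _ (by simp) (by simp) (by simp) (by simp), by simp [h3'],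
          by simp [h4'], by simp [h5'], fun k' hk' i' hi' j' hj' hb => ?_,
          fun i' hi' j' hj' hb => ?_, fun i' hi' j' hj' hb => ?_⟩
        · rw [Memory.setIdx_num]
          by_cases he : k' = k ∧ i' = i ∧ j' = j
          · obtain ⟨rfl, rfl, rfl⟩ := he
            exact e1
          · rw [e3 k' i' j' (by omega)]
            exact hM.1 k' hk' i' hi' j' hj' (by omega)
        · rw [Memory.setIdx_num]
          by_cases he : i' = i ∧ j' = j
          · obtain ⟨rfl, rfl⟩ := he
            exact e2
          · rw [e3 n i' j' (by omega)]
            exact hM.2.1 i' hi' j' hj' (by omega)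
        · rw [Memory.setIdx_num, e3 n i' j' (by omega)]
          exact hM.2.2 i' hi' j' hj' (by omega)
      · obtain ⟨hF, h3, h4, h5, hM⟩ := h
        exact ⟨hF.setIdx _ (by simp) (by simp) (by simp) (by simp), by simp [h3], by simp [h4],
          hM.next_row⟩
    · obtain ⟨hF, h3, h4, hM⟩ := h
      exact ⟨hF.setIdx _ (by simp) (by simp) (by simp) (by simp), by simp [h3], hM.next_slice⟩
  · obtain ⟨hF, h3, hM⟩ := h
    refine ⟨hF, fun k hk i hi j hj => ?_⟩
    rcases hk.lt_or_eq with hk | rfl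
    · rw [testMatrix, if_pos hk, hM.1 k hk i hi j hj (Or.inl hk)]
    · rw [testMatrix, if_neg (lt_irrefl k), hM.2.2 i hi j hj (by omega)]

end Partials

section Main

variable {K : Type} [Field K] [LinearOrder K]

/-- The numbers that occur in the run of the program on the input array `c` have the property `G`. -/
structure Admissible (G : K → Prop) (n : ℕ) (c : ℕ → ℕ → ℕ → K) : Prop where
  zero : G 0
  input : ∀ k i j, G (c k i j)
  doubled : ∀ k < n, ∀ i < n, ∀ j < n, G (doubledEntry c k i j)
  doubled_add : ∀ k < n, ∀ i < n, ∀ j < n,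
    G (doubledEntry c k i j + if k = i then doubledEntry c k i j else 0)
  entry : ∀ k < n, ∀ i < n, ∀ j < n, G (partialEntry c k i j)
  entry_sum : ∀ m ≤ n, ∀ i < n, ∀ j < n, G (∑ l ∈ Finset.range m, partialEntry c l i j)
  row : ∀ k ≤ n, ∀ i < n, ∀ m ≤ n, G (∑ j ∈ Finset.range m, testMatrix c n k i j)
  total : ∀ k ≤ n, ∀ m ≤ n, G (∑ i ∈ Finset.range m, rowSum n (testMatrix c n k) i)
  row_mul_row : ∀ k ≤ n, ∀ i < n, ∀ j < n,
    G (rowSum n (testMatrix c n k) i * rowSum n (testMatrix c n k) j)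
  total_mul : ∀ k ≤ n, ∀ i < n, ∀ j < n,
    G (totalSum n (testMatrix c n k) * testMatrix c n k i j)
  stage : ∀ k ≤ n, ∀ p ≤ n, ∀ i < n, ∀ j < n,
    G (eliminate (defect n (testMatrix c n k)) p i j)
  product : ∀ k ≤ n, ∀ p < n, ∀ i < n, ∀ j < n,
    G (eliminate (defect n (testMatrix c n k)) p i p *
      eliminate (defect n (testMatrix c n k)) p p j)
  quotient : ∀ k ≤ n, ∀ p < n, ∀ i < n, ∀ j < n,
    G (eliminate (defect n (testMatrix c n k)) p i p *
      eliminate (defect n (testMatrix c n k)) p p j /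
      eliminate (defect n (testMatrix c n k)) p p p)

theorem wp_logConcavityProgram {G : K → Prop} {n : ℕ} {c : ℕ → ℕ → ℕ → K} {s : Memory K}
    (hG : Admissible G n c) (hidx : ∀ r, s.idx r = if r = 0 then n else 0)
    (hnum : ∀ a i j k, s.num a i j k = if a = 0 then c i j k else 0) :
    Wp G [logConcavityProgram] (400 * (n + 1) ^ 4) (fun s' => Answer (Accepts n c) s') s := by
  set A := testMatrix c n
  have hmain : ∀ s : Memory K, InputFrame n c s →
      (∀ k ≤ n, ∀ i < n, ∀ j < n, s.num 1 k i j = A k i j) →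
      Wp G [forLoop 3 2 <|
        .seq sumsProgram <| .seq defectProgram <| .seq eliminateProgram checkZeroProgram]
        ((n + 1) * (n * (n * 4 + 10) + 5 + (n * (n * 8 + 6) + 3 + (n * (n * (n * 8 + 6) + 13) + 3 +
          (n * (n * 8 + 6) + 3) + 1) + 1) + 1 + 3) + 3)
        (fun s' => Answer (Accepts n c) s') s := by
    intro s hF hA
    refine wp_forLoop (N := n + 1)
      (fun k s' => (s'.idx 0 = n ∧ s'.idx 2 = n + 1 ∧ s'.idx 8 = 0 ∧ s'.num 7 0 0 0 = 0 ∧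
        ∀ k ≤ n, ∀ i < n, ∀ j < n, s'.num 1 k i j = A k i j) ∧ s'.idx 3 = k ∧
        Answer (∀ k' < k, EliminationPasses n (defect n (A k'))) s')
      ⟨⟨by simp [hF.idx0], by simp [hF.idx2], by simp [hF.idx8], hF.zero, hA⟩, by simp,
        fun _ => by simp [hF.idx1], fun h => absurd (by simp) h⟩
      (fun m s h => ⟨h.2.1, h.1.2.1⟩) (fun k hk s h => ?_) fun s h => ?_
    · obtain ⟨⟨h0, h2, h8, hz, hA⟩, h3, hV⟩ := h
      have hk : k ≤ n := by omega
      refine wp_seq ((wp_sumsProgram hG.zero (hG.row k hk) (hG.total k hk) hk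
        ⟨h0, h2, h3, h8, hz, hA⟩ hV).mono le_rfl ?_)
      rintro s ⟨hF, hV, htot, hrow⟩
      refine wp_seq ((wp_defectProgram (hG.row_mul_row k hk) (hG.total_mul k hk)
        (hG.stage k hk 0 (Nat.zero_le n)) hk hF hV htot hrow).mono le_rfl ?_)
      rintro s ⟨⟨hF, hV⟩, hM⟩
      refine wp_seq ((wp_eliminateProgram (hG.product k hk) (hG.quotient k hk)
        (fun p hp => hG.stage k hk (p + 1) hp) hF hV hM).mono le_rfl ?_)
      rintro s ⟨⟨hF, hV⟩, hM⟩
      refine (wp_checkZeroProgram hF hV hM).mono le_rfl ?_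
      rintro s ⟨hF, hV⟩
      have hF' := hF.matrices
      refine ⟨⟨by simp [hF.idx0], by simp [hF.idx2], by simp [hF.idx8], hF.zero, hF.matrices⟩,
        by simp [hF.idx3], (hV.congr ?_).setIdx _ (by simp)⟩
      rw [Nat.forall_lt_succ_right, EliminationPasses, and_assoc]
    · exact h.2.2.congr (by simp [Accepts, A])
  refine (wp_seq (T₁ := 7) (wp_seq (T₁ := 1) (T₂ := 5) (wp_idxZero (wp_seq (T₁ := 1) (T₂ := 3)
    (wp_idxSucc (wp_seq (T₁ := 1) (T₂ := 1) (wp_idxCopy (wp_idxSucc (wp_seq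
    ((wp_partialsProgram hG.doubled hG.doubled_add hG.entry hG.entry_sum
      ⟨?_, ?_, ?_, ?_, ?_, ?_⟩ ?_).mono le_rfl fun s h => hmain s h.1 h.2)))))))))).of_le ?_
  · simp [hidx]
  · simp [hidx]
  · simp [hidx]
  · simp [hidx]
  · simp [hnum]
  · simp [hnum]
  · simp [hnum]
  · nlinarith [Nat.zero_le n, Nat.zero_le (n ^ 2), Nat.zero_le (n ^ 3), Nat.zero_le (n ^ 4)]

theorem run_logConcavityProgram {G : K → Prop} {n : ℕ} (f : MvPolynomial (Fin n) K)
    (hG : Admissible G n (inputArray f)) :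
    AnswersWithin logConcavityProgram (cubicInput f) (400 * (n + 1) ^ 4)
        (Accepts n (inputArray f)) ∧
      ∀ t a i j k, G ((run logConcavityProgram (cubicInput f) t).mem.num a i j k) := by
  have hnum : ∀ a i j k, (cubicInput f).num a i j k
      = if a = 0 then inputArray f i j k else 0 := by
    intro a i j k
    by_cases ha : a = 0
    · subst ha
      rfl
    · simp [cubicInput, ha]
  have h := (wp_logConcavityProgram hG (s := cubicInput f) (fun r => rfl) hnum).run
    (fun a i j k => by
      rw [hnum]
      split_ifs
      · exact hG.input i j k
      · exact hG.zero)
  exact ⟨⟨h.1, h.2.1⟩, h.2.2⟩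

end Main

end ArithRAM

/-! ### The stages of the elimination are quotients of minors -/

section Minors

variable {K : Type*} [Field K] {n : ℕ}

/-- The matrix with the rows of `M` at the indices in `S`, and the rows of the identity matrix
elsewhere. Its determinant is the principal minor of `M` for `S`. -/
def pivotMatrix {R : Type*} [Zero R] [One R] (M : ℕ → ℕ → R) (S : Finset (Fin n)) :
    Matrix (Fin n) (Fin n) R :=
  Matrix.of fun i j => if i ∈ S then M i j else if i = j then 1 else 0

/-- Cramer's rule for a row that is a combination of the rows in `S` and a remainder that vanishes
at the columns in `S`. -/
theorem det_pivotMatrix_updateRow {M : ℕ → ℕ → K} {S : Finset (Fin n)} {v e q : Fin n → K}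
    (hv : ∀ j : Fin n, v j = ∑ s ∈ S, q s * M s j + e j) (he : ∀ s ∈ S, e s = 0) {j : Fin n}
    (hj : j ∉ S) : ((pivotMatrix M S).updateRow j v).det = e j * (pivotMatrix M S).det := by
  have h : v = ∑ s, (if s ∈ S then q s else e s) • (pivotMatrix M S) s := by
    funext l
    rw [hv, Finset.sum_apply, ← Finset.sum_add_sum_compl S]
    congr 1
    · exact Finset.sum_congr rfl fun s hs => by simp [pivotMatrix, hs]
    · by_cases hl : l ∈ S
      · rw [he l hl]
        refine (Finset.sum_eq_zero fun s hs => ?_).symm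
        have hs := Finset.mem_compl.1 hs
        have : s ≠ l := fun h => hs (h ▸ hl)
        simp [pivotMatrix, hs, this]
      · rw [Finset.sum_eq_single l (fun s hs hsl => ?_) (fun h => by simp [hl] at h)]
        · simp [pivotMatrix, hl]
        · simp [pivotMatrix, Finset.mem_compl.1 hs, hsl]
  rw [h, Matrix.det_updateRow_sum, if_neg hj, smul_eq_mul]

/-- After `p` steps with the set `S` of nonzero pivots, the elimination has subtracted from each row a
combination of the rows in `S`, and has cleared the columns in `S`. -/
theorem exists_pivots (M : ℕ → ℕ → K) {p : ℕ} (hp : p ≤ n) :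
    ∃ S : Finset (Fin n), (∀ s ∈ S, (s : ℕ) < p) ∧ (pivotMatrix M S).det ≠ 0 ∧
      ∀ i, (∃ q : Fin n → K, ∀ j, M i j = ∑ s ∈ S, q s * M s j + eliminate M p i j) ∧
        ∀ s ∈ S, eliminate M p i s = 0 := by
  induction p with
  | zero =>
    refine ⟨∅, by simp, ?_, fun i => ⟨⟨0, fun j => by simp [eliminate]⟩, by simp⟩⟩
    have : pivotMatrix M (∅ : Finset (Fin n)) = 1 := by
      ext i j
      simp [pivotMatrix, Matrix.one_apply]
    rw [this, Matrix.det_one]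
    exact one_ne_zero
  | succ p ih =>
    obtain ⟨S, hS, hdet, hrow⟩ := ih (by omega)
    by_cases hpp : eliminate M p p p = 0
    · have hE : ∀ i j, eliminate M (p + 1) i j = eliminate M p i j := fun i j => by
        rw [eliminate, hpp, div_zero, sub_zero]
      exact ⟨S, fun s hs => (hS s hs).trans (Nat.lt_succ_self p), hdet, by simpa only [hE] using hrow⟩
    set P : Fin n := ⟨p, hp⟩
    have hPS : P ∉ S := fun h => lt_irrefl p (hS P h)
    obtain ⟨⟨qp, hqp⟩, hzp⟩ := hrow p
    refine ⟨insert P S, fun s hs => ?_, ?_, fun i => ?_⟩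
    · rcases Finset.mem_insert.1 hs with rfl | hs
      · exact Nat.lt_succ_self p
      · exact (hS s hs).trans (Nat.lt_succ_self p)
    · have h : pivotMatrix M (insert P S) = (pivotMatrix M S).updateRow P fun j => M p j := by
        ext i j
        rw [Matrix.updateRow_apply]
        by_cases hi : i = P
        · subst hi
          simp [pivotMatrix, P]
        · simp [pivotMatrix, hi]
      rw [h, det_pivotMatrix_updateRow (v := fun j => M p j) (e := fun j => eliminate M p p j)
        (fun j => hqp j) hzp hPS]
      exact mul_ne_zero hpp hdet
    · obtain ⟨⟨q, hq⟩, hz⟩ := hrow i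
      refine ⟨⟨fun s => if s = P then eliminate M p i p / eliminate M p p p
        else q s - eliminate M p i p / eliminate M p p p * qp s, fun j => ?_⟩, fun s hs => ?_⟩
      · rw [Finset.sum_insert hPS]
        beta_reduce
        rw [if_pos rfl, eliminate]
        have h : ∑ s ∈ S, (if s = P then eliminate M p i p / eliminate M p p p
            else q s - eliminate M p i p / eliminate M p p p * qp s) * M s j
            = ∑ s ∈ S, q s * M s j
              - eliminate M p i p / eliminate M p p p * ∑ s ∈ S, qp s * M s j := by
          rw [Finset.mul_sum, ← Finset.sum_sub_distrib]
          refine Finset.sum_congr rfl fun s hs => ?_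
          rw [if_neg fun h : s = P => hPS (h ▸ hs)]
          ring
        rw [h, hq j]
        change _ = _ / _ * M p j + _ + _
        rw [hqp j]
        ring
      · rw [eliminate]
        rcases Finset.mem_insert.1 hs with rfl | hs
        · simp only [P]
          field_simp
          ring
        · rw [hz s hs, hzp s hs]
          simp

theorem eliminate_smul (M : ℕ → ℕ → K) {d : K} (hd : d ≠ 0) (p : ℕ) :
    ∀ i j, eliminate (fun i j => d * M i j) p i j = d * eliminate M p i j := by
  induction p with
  | zero => exact fun _ _ => rfl
  | succ p ih =>
    intro i j
    rw [eliminate, eliminate, ih, ih, ih, ih]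
    by_cases h : eliminate M p p p = 0
    · simp [h]
    · field_simp

end Minors

theorem abs_det_pivotMatrix_le {n : ℕ} {N : ℕ → ℕ → ℤ} {S : Finset (Fin n)} {X : ℤ} (hX : 1 ≤ X)
    (hN : ∀ i < n, ∀ j < n, |N i j| ≤ X) (i j : Fin n) :
    |(pivotMatrix N S).det| ≤ n.factorial * X ^ n ∧
      |((pivotMatrix N S).updateRow j fun l => N i l).det| ≤ n.factorial * X ^ n := by
  have h : ∀ i j, |pivotMatrix N S i j| ≤ X := by
    intro i j
    simp only [pivotMatrix, Matrix.of_apply]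
    split_ifs
    · exact hN i i.2 j j.2
    · simpa using hX
    · simpa using zero_le_one.trans hX
  constructor
  · simpa using Matrix.det_le (abv := AbsoluteValue.abs) (A := pivotMatrix N S) (x := X) h
  · have := Matrix.det_le (abv := AbsoluteValue.abs)
      (A := (pivotMatrix N S).updateRow j fun l => N i l) (x := X) fun a b => by
        rw [Matrix.updateRow_apply]
        split_ifs
        · exact hN i i.2 b b.2
        · exact h a b
    simpa using this

/-- For a rational matrix with the common denominator `d`, the entries of all stages of the
elimination are quotients of integers that are bounded by determinants. -/
theorem exists_eliminate_eq_div {n d : ℕ} (hd : 0 < d) {M : ℕ → ℕ → ℚ} {N : ℕ → ℕ → ℤ} {X : ℤ}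
    (hX : 1 ≤ X) (hMN : ∀ i < n, ∀ j < n, (d : ℚ) * M i j = N i j)
    (hN : ∀ i < n, ∀ j < n, |N i j| ≤ X) {p i j : ℕ} (hp : p ≤ n) (hi : i < n) (hj : j < n) :
    ∃ a b : ℤ, b ≠ 0 ∧ eliminate M p i j = a / b ∧ |a| ≤ n.factorial * X ^ n ∧
      |b| ≤ d * (n.factorial * X ^ n) := by
  have hd' : (d : ℚ) ≠ 0 := by exact_mod_cast hd.ne'
  obtain ⟨S, -, hdet, hrow⟩ := exists_pivots (n := n) (fun i j => (d : ℚ) * M i j) hp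
  obtain ⟨⟨q, hq⟩, hz⟩ := hrow i
  have hmap : pivotMatrix (fun i j => (d : ℚ) * M i j) S
      = (pivotMatrix N S).map (Int.castRingHom ℚ) := by
    ext a b
    simp only [pivotMatrix, Matrix.of_apply, Matrix.map_apply]
    split_ifs
    · simpa using hMN a a.2 b b.2
    · simp
    · simp
  have hb : (pivotMatrix N S).det ≠ 0 := by
    intro h
    rw [hmap] at hdet
    refine hdet ?_
    have := (RingHom.map_det (Int.castRingHom ℚ) (pivotMatrix N S)).symm
    rw [h, map_zero] at this
    exact this
  obtain ⟨h1, h2⟩ := abs_det_pivotMatrix_le (S := S) hX hN ⟨i, hi⟩ ⟨j, hj⟩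
  by_cases hjS : (⟨j, hj⟩ : Fin n) ∈ S
  · refine ⟨0, 1, one_ne_zero, ?_, by simpa using (abs_nonneg _).trans h1, ?_⟩
    · have := hz _ hjS
      rw [eliminate_smul _ hd'] at this
      simpa [hd'] using this
    · have h3 : (1 : ℤ) ≤ |(pivotMatrix N S).det| := Int.one_le_abs hb
      have h4 : (1 : ℤ) ≤ d := by exact_mod_cast hd
      rw [abs_one]
      nlinarith
  · refine ⟨((pivotMatrix N S).updateRow ⟨j, hj⟩ fun l => N i l).det,
      d * (pivotMatrix N S).det, mul_ne_zero (by exact_mod_cast hd.ne') hb, ?_, h2, ?_⟩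
    · have h3 := det_pivotMatrix_updateRow (M := fun i j => (d : ℚ) * M i j)
        (v := fun l : Fin n => (d : ℚ) * M i l) (e := fun l : Fin n => eliminate (fun i j => (d : ℚ) * M i j) p i l)
        (fun l => hq l) hz hjS
      have hmap' : (pivotMatrix (fun i j => (d : ℚ) * M i j) S).updateRow ⟨j, hj⟩
          (fun l : Fin n => (d : ℚ) * M i l)
          = ((pivotMatrix N S).updateRow ⟨j, hj⟩ fun l => N i l).map (Int.castRingHom ℚ) := by
        rw [hmap]
        ext a b
        simp only [Matrix.updateRow_apply, Matrix.map_apply]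
        split_ifs
        · simpa using hMN i hi b b.2
        · rfl
      have e1 := RingHom.map_det (Int.castRingHom ℚ) (pivotMatrix N S)
      have e2 := RingHom.map_det (Int.castRingHom ℚ)
        ((pivotMatrix N S).updateRow ⟨j, hj⟩ fun l => N i l)
      simp only [RingHom.mapMatrix_apply] at e1 e2
      rw [hmap', hmap, ← e1, ← e2, eliminate_smul _ hd'] at h3
      simp only [eq_intCast] at h3
      have hb' : ((pivotMatrix N S).det : ℚ) ≠ 0 := by exact_mod_cast hb
      rw [Int.cast_mul, Int.cast_natCast, eq_div_iff (mul_ne_zero hd' hb'), h3]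
      ring
    · rw [abs_mul, Nat.abs_cast]
      exact mul_le_mul_of_nonneg_left h1 (by positivity)

/-! ### Bit lengths -/

/-- The rational number is a quotient of two integers of absolute value at most `2 ^ e`. -/
def IsShort (e : ℕ) (q : ℚ) : Prop :=
  ∃ a b : ℤ, b ≠ 0 ∧ q = a / b ∧ |a| ≤ 2 ^ e ∧ |b| ≤ 2 ^ e

theorem IsShort.mono {e e' : ℕ} {q : ℚ} (h : IsShort e q) (he : e ≤ e') : IsShort e' q := by
  obtain ⟨a, b, hb, hq, h1, h2⟩ := h
  have : (2 : ℤ) ^ e ≤ 2 ^ e' := pow_le_pow_right₀ (by norm_num) he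
  exact ⟨a, b, hb, hq, h1.trans this, h2.trans this⟩

theorem IsShort.mul {e e' : ℕ} {q q' : ℚ} (h : IsShort e q) (h' : IsShort e' q') :
    IsShort (e + e') (q * q') := by
  obtain ⟨a, b, hb, rfl, h1, h2⟩ := h
  obtain ⟨a', b', hb', rfl, h1', h2'⟩ := h'
  refine ⟨a * a', b * b', mul_ne_zero hb hb', by push_cast; rw [div_mul_div_comm], ?_, ?_⟩
  · rw [abs_mul, pow_add]
    exact mul_le_mul h1 h1' (abs_nonneg _) (by positivity)
  · rw [abs_mul, pow_add]
    exact mul_le_mul h2 h2' (abs_nonneg _) (by positivity)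

theorem IsShort.inv {e : ℕ} {q : ℚ} (h : IsShort e q) : IsShort e q⁻¹ := by
  obtain ⟨a, b, hb, rfl, h1, h2⟩ := h
  by_cases ha : a = 0
  · exact ⟨0, 1, one_ne_zero, by simp [ha], by simp, by simpa using one_le_pow₀ (by norm_num)⟩
  · exact ⟨b, a, ha, by rw [inv_div], h2, h1⟩

theorem IsShort.div {e e' : ℕ} {q q' : ℚ} (h : IsShort e q) (h' : IsShort e' q') :
    IsShort (e + e') (q / q') := by
  rw [div_eq_mul_inv]
  exact h.mul h'.inv

theorem IsShort.bitLength_le {e : ℕ} {q : ℚ} (h : IsShort e q) : bitLength q ≤ 2 * (e + 1) := by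
  obtain ⟨a, b, hb, rfl, h1, h2⟩ := h
  -- lowest terms divide the given numerator and denominator
  have hlt : ∀ z : ℤ, |z| ≤ 2 ^ e → z.natAbs < 2 ^ (e + 1) := by
    intro z hz
    have h3 : (z.natAbs : ℤ) ≤ 2 ^ e := by simpa using hz
    have h4 : z.natAbs ≤ 2 ^ e := by exact_mod_cast h3
    exact h4.trans_lt (Nat.pow_lt_pow_right (by norm_num) (Nat.lt_succ_self e))
  rw [← Rat.divInt_eq_div]
  have hnum : (Rat.divInt a b).num.natAbs.size ≤ e + 1 := by
    refine Nat.size_le.2 ?_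
    by_cases ha : a = 0
    · simp [ha]
    · exact (Nat.le_of_dvd (Int.natAbs_pos.2 ha)
        (Int.natAbs_dvd_natAbs.2 (Rat.num_dvd a hb))).trans_lt (hlt a h1)
  have hden : (Rat.divInt a b).den.size ≤ e + 1 := by
    refine Nat.size_le.2 ((Nat.le_of_dvd (Int.natAbs_pos.2 hb) ?_).trans_lt (hlt b h2))
    exact Int.natCast_dvd.1 (Rat.den_dvd a b)
  unfold bitLength
  omega

/-- With the denominator `d`, the rational number is a natural number that is at most `B`. -/
def IsScaled (d B : ℕ) (q : ℚ) : Prop := ∃ z : ℕ, (d : ℚ) * q = z ∧ z ≤ B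

theorem IsScaled.mono {d B B' : ℕ} {q : ℚ} (h : IsScaled d B q) (hB : B ≤ B') :
    IsScaled d B' q := by
  obtain ⟨z, h1, h2⟩ := h
  exact ⟨z, h1, h2.trans hB⟩

theorem isScaled_zero (d B : ℕ) : IsScaled d B 0 := ⟨0, by simp, Nat.zero_le B⟩

theorem IsScaled.add {d B B' : ℕ} {q q' : ℚ} (h : IsScaled d B q) (h' : IsScaled d B' q') :
    IsScaled d (B + B') (q + q') := by
  obtain ⟨z, h1, h2⟩ := h
  obtain ⟨z', h1', h2'⟩ := h'
  exact ⟨z + z', by push_cast; rw [mul_add, h1, h1'], by omega⟩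

theorem IsScaled.sum_range {d B m : ℕ} {q : ℕ → ℚ} (h : ∀ i < m, IsScaled d B (q i)) :
    IsScaled d (m * B) (∑ i ∈ Finset.range m, q i) := by
  induction m with
  | zero => simpa using isScaled_zero d 0
  | succ m ih =>
    rw [Finset.sum_range_succ, Nat.succ_mul]
    exact (ih fun i hi => h i (by omega)).add (h m (Nat.lt_succ_self m))

theorem IsScaled.mul {d d' B B' : ℕ} {q q' : ℚ} (h : IsScaled d B q) (h' : IsScaled d' B' q') :
    IsScaled (d * d') (B * B') (q * q') := by
  obtain ⟨z, h1, h2⟩ := h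
  obtain ⟨z', h1', h2'⟩ := h'
  refine ⟨z * z', ?_, Nat.mul_le_mul h2 h2'⟩
  push_cast
  rw [mul_mul_mul_comm, h1, h1']

theorem IsScaled.isShort {d B e : ℕ} {q : ℚ} (h : IsScaled d B q) (hd : 0 < d) (hde : d ≤ 2 ^ e)
    (hB : B ≤ 2 ^ e) : IsShort e q := by
  obtain ⟨z, h1, h2⟩ := h
  have hd' : (d : ℚ) ≠ 0 := by exact_mod_cast hd.ne'
  refine ⟨z, d, by exact_mod_cast hd.ne', ?_, ?_, ?_⟩
  · push_cast
    rw [eq_div_iff hd', mul_comm, h1]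
  · rw [Nat.abs_cast]
    exact_mod_cast h2.trans hB
  · rw [Nat.abs_cast]
    exact_mod_cast hde

/-- The product of the denominators of the coefficients is a common denominator. -/
theorem exists_common_denominator {n : ℕ} {f : MvPolynomial (Fin n) ℚ} (hc : ∀ m, 0 ≤ f.coeff m) :
    ∃ d : ℕ, 0 < d ∧ d ≤ 2 ^ inputSize f ∧
      ∀ m, IsScaled d (2 ^ inputSize f) (f.coeff m) := by
  have hL : 2 ^ ∑ m ∈ f.support, bitLength (f.coeff m) ≤ 2 ^ inputSize f :=
    Nat.pow_le_pow_right (by norm_num) (Nat.le_add_left _ _)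
  refine ⟨∏ m ∈ f.support, (f.coeff m).den, Finset.prod_pos fun m _ => (f.coeff m).pos,
    le_trans ?_ hL, fun m => IsScaled.mono ?_ hL⟩
  · rw [← Finset.prod_pow_eq_pow_sum]
    refine Finset.prod_le_prod' fun m _ => (Nat.lt_size_self _).le.trans
      (Nat.pow_le_pow_right (by norm_num) (Nat.le_add_left _ _))
  · by_cases hm : m ∈ f.support
    · refine ⟨(f.coeff m).num.natAbs * ∏ l ∈ f.support.erase m, (f.coeff l).den, ?_, ?_⟩
      · rw [← Finset.mul_prod_erase _ _ hm]
        have h1 : ((f.coeff m).num.natAbs : ℚ) = (f.coeff m).num := by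
          rw [← Int.cast_natCast, Int.natAbs_of_nonneg (Rat.num_nonneg.2 (hc m))]
        rw [Nat.cast_mul, Nat.cast_mul, h1, mul_right_comm, mul_comm ((f.coeff m).den : ℚ),
          Rat.mul_den_eq_num]
      · rw [← Finset.add_sum_erase _ _ hm, pow_add, ← Finset.prod_pow_eq_pow_sum]
        refine Nat.mul_le_mul ?_ ?_
        · exact (Nat.lt_size_self _).le.trans
            (Nat.pow_le_pow_right (by norm_num) (Nat.le_add_right _ _))
        · exact Finset.prod_le_prod' fun m _ => (Nat.lt_size_self _).le.trans
            (Nat.pow_le_pow_right (by norm_num) (Nat.le_add_left _ _))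
    · rw [MvPolynomial.notMem_support_iff.1 hm]
      exact isScaled_zero _ _

section BitLength

variable {n L d : ℕ} {c : ℕ → ℕ → ℕ → ℚ}

theorem isScaled_doubledEntry (h : ∀ i j k, IsScaled d (2 ^ L) (c i j k)) (k i j : ℕ) :
    IsScaled d (2 * 2 ^ L) (doubledEntry c k i j) := by
  unfold doubledEntry
  split_ifs
  · exact ((h k i j).add (h k i j)).mono (by omega)
  · exact (h k i j).mono (by omega)

theorem isScaled_doubledEntry_add (h : ∀ i j k, IsScaled d (2 ^ L) (c i j k)) (k i j : ℕ) :
    IsScaled d (4 * 2 ^ L)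
      (doubledEntry c k i j + if k = i then doubledEntry c k i j else 0) := by
  have h1 := isScaled_doubledEntry h k i j
  split_ifs
  · exact (h1.add h1).mono (by omega)
  · exact (h1.add (isScaled_zero d 0)).mono (by omega)

theorem isScaled_partialEntry (h : ∀ i j k, IsScaled d (2 ^ L) (c i j k)) (k i j : ℕ) :
    IsScaled d (6 * 2 ^ L) (partialEntry c k i j) := by
  have h1 := isScaled_doubledEntry h k i j
  have h2 := isScaled_doubledEntry_add h k i j
  unfold partialEntry
  split_ifs at h2 ⊢
  · exact (h2.add h1).mono (by omega)
  · exact (h2.add (isScaled_zero d 0)).mono (by omega)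
  · exact (h2.add h1).mono (by omega)
  · exact (h2.add (isScaled_zero d 0)).mono (by omega)

theorem isScaled_testMatrix (h : ∀ i j k, IsScaled d (2 ^ L) (c i j k)) (k i j : ℕ) :
    IsScaled d ((n + 1) * (6 * 2 ^ L)) (testMatrix c n k i j) := by
  unfold testMatrix
  split_ifs
  · exact (isScaled_partialEntry h k i j).mono (Nat.le_mul_of_pos_left _ (Nat.succ_pos n))
  · exact (IsScaled.sum_range fun l _ => isScaled_partialEntry h l i j).mono
      (Nat.mul_le_mul_right _ (Nat.le_succ n))

/-- All numbers that occur in the run of the program have polynomial bit length. -/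
theorem admissible_isShort (hnL : n ≤ L) (hd : 0 < d) (hdL : d ≤ 2 ^ L)
    (h : ∀ i j k, IsScaled d (2 ^ L) (c i j k)) :
    ArithRAM.Admissible (IsShort (3 * (9 * L ^ 2 + 8 * L + 8))) n c := by
  set e := 4 * L + 3 with he
  set E := 9 * L ^ 2 + 8 * L + 8 with hE
  have hLE : 2 * e ≤ E := by nlinarith
  have hn : n + 1 ≤ 2 ^ L := hnL.trans_lt (Nat.lt_two_pow_self)
  have hB : (n + 1) * ((n + 1) * ((n + 1) * (6 * 2 ^ L))) ≤ 2 ^ e := by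
    calc (n + 1) * ((n + 1) * ((n + 1) * (6 * 2 ^ L)))
        ≤ 2 ^ L * (2 ^ L * (2 ^ L * (8 * 2 ^ L))) := by gcongr; norm_num
      _ = 2 ^ e := by rw [he, pow_add, pow_mul']; ring
  have hde : d ≤ 2 ^ e := hdL.trans (Nat.pow_le_pow_right (by norm_num) (by omega))
  have h1n : ∀ x, x ≤ (n + 1) * x := fun x => Nat.le_mul_of_pos_left _ (Nat.succ_pos n)
  have hB2 : (n + 1) * ((n + 1) * (6 * 2 ^ L)) ≤ 2 ^ e := (h1n _).trans hB
  have hB1 : (n + 1) * (6 * 2 ^ L) ≤ 2 ^ e := (h1n _).trans hB2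
  have hB0 : 6 * 2 ^ L ≤ 2 ^ e := (h1n _).trans hB1
  have hshort : ∀ {B : ℕ} {q : ℚ}, IsScaled d B q → B ≤ 2 ^ e → IsShort (3 * E) q := fun hq hBq =>
    (hq.isShort hd hde hBq).mono (by omega)
  have hA := isScaled_testMatrix (n := n) h
  have hrow : ∀ k i m, m ≤ n →
      IsScaled d (2 ^ e) (∑ j ∈ Finset.range m, testMatrix c n k i j) := fun k i m hm =>
    (IsScaled.sum_range fun j _ => hA k i j).mono
      ((Nat.mul_le_mul_right _ (by omega)).trans hB2)
  have htot : ∀ k m, m ≤ n →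
      IsScaled d (2 ^ e) (∑ i ∈ Finset.range m, rowSum n (testMatrix c n k) i) := fun k m hm =>
    (IsScaled.sum_range fun i _ => (IsScaled.sum_range fun j _ => hA k i j)).mono
      ((Nat.mul_le_mul (by omega) (Nat.mul_le_mul_right _ (by omega))).trans hB)
  have hp1 : ∀ k i j, IsScaled (d * d) (2 ^ (2 * e))
      (rowSum n (testMatrix c n k) i * rowSum n (testMatrix c n k) j) := fun k i j =>
    ((hrow k i n le_rfl).mul (hrow k j n le_rfl)).mono (by rw [← pow_add]; exact (by rw [two_mul]))
  have hp2 : ∀ k i j, IsScaled (d * d) (2 ^ (2 * e))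
      (totalSum n (testMatrix c n k) * testMatrix c n k i j) := fun k i j =>
    ((htot k n le_rfl).mul ((hA k i j).mono hB1)).mono (by rw [← pow_add]; exact (by rw [two_mul]))
  have hdd : d * d ≤ 2 ^ (2 * e) := by
    rw [two_mul, pow_add]
    exact Nat.mul_le_mul hde hde
  have hfact : ((n.factorial : ℕ) : ℤ) * (2 ^ (2 * e)) ^ n ≤ 2 ^ (L * L + 2 * e * L) := by
    have h1 : n.factorial ≤ 2 ^ (L * L) := by
      calc n.factorial ≤ n ^ n := Nat.factorial_le_pow n
        _ ≤ (2 ^ L) ^ n := Nat.pow_le_pow_left (by omega) n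
        _ = 2 ^ (L * n) := (pow_mul 2 L n).symm
        _ ≤ 2 ^ (L * L) := Nat.pow_le_pow_right (by norm_num) (Nat.mul_le_mul_left L hnL)
    have h2 : ((2 : ℕ) ^ (2 * e)) ^ n ≤ 2 ^ (2 * e * L) := by
      rw [← pow_mul]
      exact Nat.pow_le_pow_right (by norm_num) (Nat.mul_le_mul_left _ hnL)
    have h3 := Nat.mul_le_mul h1 h2
    rw [← pow_add] at h3
    exact_mod_cast h3
  have hstage : ∀ k, ∀ p ≤ n, ∀ i < n, ∀ j < n,
      IsShort E (eliminate (defect n (testMatrix c n k)) p i j) := by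
    intro k p hp i hi j hj
    -- over the denominator `d²`, the entries of the defect are differences of two natural numbers
    choose z₁ hz₁ hz₁' using hp1 k
    choose z₂ hz₂ hz₂' using hp2 k
    obtain ⟨a, b, hb, hq, ha, hb'⟩ := exists_eliminate_eq_div (n := n) (d := d * d)
      (M := defect n (testMatrix c n k)) (N := fun i j => (z₁ i j : ℤ) - z₂ i j)
      (X := 2 ^ (2 * e)) (Nat.mul_pos hd hd) (one_le_pow₀ (by norm_num))
      (fun i _ j _ => by rw [defect, mul_sub, hz₁, hz₂]; push_cast; ring)
      (fun i _ j _ => by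
        have q1 : (z₁ i j : ℤ) ≤ 2 ^ (2 * e) := by exact_mod_cast hz₁' i j
        have q2 : (z₂ i j : ℤ) ≤ 2 ^ (2 * e) := by exact_mod_cast hz₂' i j
        rw [abs_le]
        constructor <;> omega) hp hi hj
    refine ⟨a, b, hb, hq, ha.trans (hfact.trans ?_), hb'.trans ?_⟩
    · refine pow_le_pow_right₀ (by norm_num) ?_
      rw [hE, he]
      nlinarith
    · have hddL : ((d * d : ℕ) : ℤ) ≤ 2 ^ (L + L) := by
        rw [pow_add]
        exact_mod_cast Nat.mul_le_mul hdL hdL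
      refine (mul_le_mul hddL hfact (by positivity) (by positivity)).trans ?_
      rw [← pow_add]
      refine pow_le_pow_right₀ (by norm_num) ?_
      rw [hE, he]
      nlinarith
  constructor
  · exact hshort (isScaled_zero d 0) (Nat.zero_le _)
  · exact fun k i j => hshort (h k i j) (by omega)
  · exact fun k _ i _ j _ => hshort (isScaled_doubledEntry h k i j) (by omega)
  · exact fun k _ i _ j _ => hshort (isScaled_doubledEntry_add h k i j) (by omega)
  · exact fun k _ i _ j _ => hshort (isScaled_partialEntry h k i j) hB0
  · exact fun m hm i _ j _ => hshort (IsScaled.sum_range fun l _ => isScaled_partialEntry h l i j)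
      ((Nat.mul_le_mul_right _ (by omega)).trans hB1)
  · exact fun k _ i _ m hm => hshort (hrow k i m hm) le_rfl
  · exact fun k _ m hm => hshort (htot k m hm) le_rfl
  · exact fun k _ i _ j _ => ((hp1 k i j).isShort (Nat.mul_pos hd hd) hdd le_rfl).mono (by omega)
  · exact fun k _ i _ j _ => ((hp2 k i j).isShort (Nat.mul_pos hd hd) hdd le_rfl).mono (by omega)
  · exact fun k _ p hp i hi j hj => (hstage k p hp i hi j hj).mono (by omega)
  · exact fun k _ p hp i hi j hj => ((hstage k p hp.le i hi p hp).mul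
      (hstage k p hp.le p hp j hj)).mono (by omega)
  · exact fun k _ p hp i hi j hj => (((hstage k p hp.le i hi p hp).mul
      (hstage k p hp.le p hp j hj)).div (hstage k p hp.le p hp p hp)).mono (by omega)

end BitLength

theorem mainTheorem8 :
    ∃ (P : ArithRAM.Program) (C : ℕ) (p : Polynomial ℕ),
      (∀ (n : ℕ) (f : MvPolynomial (Fin n) ℝ), f.IsHomogeneous 3 → (∀ m, 0 ≤ f.coeff m) →
        ArithRAM.AnswersWithin P (ArithRAM.cubicInput f) (C * (n + 1) ^ 4) (IsLogConcave f)) ∧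
      (∀ (n : ℕ) (f : MvPolynomial (Fin n) ℚ), f.IsHomogeneous 3 → (∀ m, 0 ≤ f.coeff m) →
        ArithRAM.AnswersWithin P (ArithRAM.cubicInput f) (C * (n + 1) ^ 4)
          (IsLogConcave (MvPolynomial.map (algebraMap ℚ ℝ) f)) ∧
        ∀ t a i j k : ℕ,
          bitLength ((ArithRAM.run P (ArithRAM.cubicInput f) t).mem.num a i j k)
            ≤ p.eval (inputSize f)) := by
  refine ⟨ArithRAM.logConcavityProgram, 400,
    6 * (9 * Polynomial.X ^ 2 + 8 * Polynomial.X + 8) + 2, fun n f hf hc => ?_,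
    fun n f hf hc => ?_⟩
  · rw [isLogConcave_iff_accepts hf hc]
    refine (ArithRAM.run_logConcavityProgram (G := fun _ => True) f ?_).1
    constructor <;> intros <;> trivial
  · obtain ⟨d, hd, hdL, hcoeff⟩ := exists_common_denominator hc
    have hinput : ∀ i j k, IsScaled d (2 ^ inputSize f) (inputArray f i j k) := by
      intro i j k
      simp only [inputArray, ArithRAM.cubicInput]
      split_ifs
      · exact hcoeff _
      · exact isScaled_zero _ _
    have h := ArithRAM.run_logConcavityProgram f
      (admissible_isShort (L := inputSize f) (Nat.le_add_right _ _) hd hdL hinput)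
    refine ⟨?_, fun t a i j k => (h.2 t a i j k).bitLength_le.trans (le_of_eq ?_)⟩
    · rw [isLogConcave_iff_accepts (hf.map _) fun m => ?_, accepts_map_iff]
      · exact h.1
      · rw [MvPolynomial.coeff_map, eq_ratCast]
        exact_mod_cast hc m
    · simp only [Polynomial.eval_add, Polynomial.eval_mul, Polynomial.eval_pow, Polynomial.eval_X,
        Polynomial.eval_ofNat]
      ring
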